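/- Let $X$ be a locally compact Hausdorff space, let $n\ge 1$, and let $\mathcal E$ be a locally trivial bundle over $X$ with fibre $\mathbb M_n=\mathbb M_n(\mathbb C)$ and structure group $\mathrm{Aut}(\mathbb M_n)=PU(n)$ (so each fibre $\mathcal E_t$ is a $C^*$-algebra and the local trivializations are fibrewise $*$-isomorphisms onto $\mathbb M_n$). Let $A=\Gamma_0(\mathcal E)$ be the $C^*$-algebra of continuous sections of $\mathcal E$ vanishing at infinity, with pointwise operations and supremum norm (up to isomorphism, these are exactly the $n$-homogeneous $C^*$-algebras, with $X=\mathrm{Prim}(A)$). Write $M(B)$ for the multiplier algebra of a $C^*$-algebra $B$ and put - $\mathrm{TM}(B)=\{\,x\mapsto axb : a,b\in M(B)\,\}$ and $\mathrm{TM}_0(B)=\{\,x\mapsto axb : a,b\in B\,\}$, sets of operators $B\to B$; - $\mathrm{IB}(A)$ for the set of bounded linear maps $\phi:A\to A$ with $\phi(I)\subseteq I$ for every closed two-sided ideal $I$ of $A$; for $\phi\in\mathrm{IB}(A)$ and $t\in X$, $\phi_t:\mathcal E_t\to\mathcal E_t$ is the induced operator, $\phi_t(a(t))=\phi(a)(t)$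 for $a\in A$ (where $\mathcal E_t$ is identified with $A/\{a\in A: a(t)=0\}$); - $\mathrm{IB}_1(A)=\{\phi\in\mathrm{IB}(A):\phi_t\in\mathrm{TM}(\mathcal E_t)\text{ for all }t\in X\}$; - $\mathrm{IB}_0(A)=\{\phi\in\mathrm{IB}(A):(t\mapsto\|\phi_t\|)\in C_0(X)\}$ and $\mathrm{IB}_{0,1}(A)=\mathrm{IB}_0(A)\cap\mathrm{IB}_1(A)$. Consider the conditions: (a) for every open subset $U\subseteq X$, each (locally trivial) complex line subbundle of $\mathcal E|_U$ is trivial; (b) $\mathrm{IB}_1(A)=\mathrm{TM}(A)$; (c) $\mathrm{IB}_{0,1}(A)=\mathrm{TM}_0(A)$. Then (a) $\Rightarrow$ (b) $\Rightarrow$ (c). If $A$ is separable, the conditions (a), (b) and (c) are equivalent. -/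

import Mathlib

open Bundle Topology Filter Set
open scoped ENNReal MultiplierAlgebra

/-- The set `IB(A)` of bounded linear operators on a C⋆-algebra `A` that preserve every closed
two-sided ideal of `A`. -/
def IB (A : Type*) [NonUnitalNormedRing A] [NormedSpace ℂ A] : Set (A →L[ℂ] A) :=
  {φ | ∀ I : TwoSidedIdeal A, IsClosed (I : Set A) → ∀ x ∈ I, φ x ∈ I}

section TwoSidedMultiplications

variable {A : Type*} [NonUnitalNormedRing A] [NormedSpace ℂ A]
  [SMulCommClass ℂ A A] [IsScalarTower ℂ A A]

/-- The two-sided multiplication `M_{a,b} : x ↦ a x b` for multipliers `a, b ∈ M(A)`: for a double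
centralizer `m`, `m.fst x = m x` and `m.snd x = x m`. -/
noncomputable def twoSidedMul (a b : 𝓜(ℂ, A)) : A →L[ℂ] A := a.fst ∘L b.snd

variable (A) in
/-- The set `TM(A)` of two-sided multiplications with coefficients in the multiplier algebra. -/
def TM : Set (A →L[ℂ] A) := {φ | ∃ a b : 𝓜(ℂ, A), φ = twoSidedMul a b}

variable (A) in
/-- The set `TM₀(A)` of two-sided multiplications `x ↦ a x b` with coefficients in `A`. -/
def TM₀ : Set (A →L[ℂ] A) := {φ | ∃ a b : A, ∀ x, φ x = a * x * b}

end TwoSidedMultiplications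

/-- Inside the multiplier algebra of a C⋆-algebra, `M_{a,b} x` is the product `a * x * b`. -/
theorem coe_twoSidedMul {A : Type*} [NonUnitalCStarAlgebra A] (a b : 𝓜(ℂ, A)) (x : A) :
    ((twoSidedMul a b x : A) : 𝓜(ℂ, A)) = a * (x : 𝓜(ℂ, A)) * b := by
  have hl : ∀ y z : A, (∀ w : A, w * y = w * z) → y = z := by
    intro y z h
    have h1 : star (y - z) * (y - z) = 0 := by rw [mul_sub, h, sub_self]
    exact sub_eq_zero.1 (CStarRing.star_mul_self_eq_zero_iff _ |>.1 h1)
  have hr : ∀ y z : A, (∀ w : A, y * w = z * w) → y = z := by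
    intro y z h
    have h1 : (y - z) * star (y - z) = 0 := by rw [sub_mul, h, sub_self]
    exact sub_eq_zero.1 (CStarRing.mul_star_self_eq_zero_iff _ |>.1 h1)
  refine DoubleCentralizer.ext _ _ _ _ (Prod.ext ?_ ?_) <;> ext z
  · apply hl
    intro w
    change w * (a.fst (b.snd x) * z) = w * a.fst (x * b.fst z)
    rw [← mul_assoc, ← a.central, ← a.central, mul_assoc, b.central]
  · apply hr
    intro w
    change z * a.fst (b.snd x) * w = b.snd (a.snd z * x) * w
    rw [b.central, ← a.central, mul_assoc, b.central, mul_assoc]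

/-- `E` is a locally trivial bundle over `X` with fibre `𝕄ₙ(ℂ)` and structure group
`Aut(𝕄ₙ) = PU(n)`: the fibres are C⋆-algebras, and around each point of `X` there is a local
trivialization of the total space which is a ⋆-isomorphism onto `𝕄ₙ(ℂ)` on each fibre. -/
class IsMatrixBundle (n : ℕ) {X : Type*} [TopologicalSpace X] (E : X → Type*)
    [∀ t, CStarAlgebra (E t)]
    [TopologicalSpace (TotalSpace (Matrix (Fin n) (Fin n) ℂ) E)] : Prop where
  exists_trivialization : ∀ t : X,
    ∃ e : Trivialization (Matrix (Fin n) (Fin n) ℂ) (π (Matrix (Fin n) (Fin n) ℂ) E),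
      t ∈ e.baseSet ∧ ∀ s ∈ e.baseSet, ∃ ψ : E s ≃⋆ₐ[ℂ] Matrix (Fin n) (Fin n) ℂ,
        ∀ v : E s, (e ⟨s, v⟩).2 = ψ v

section Sections

variable (n : ℕ) {X : Type*} [TopologicalSpace X] (E : X → Type*)
  [TopologicalSpace (TotalSpace (Matrix (Fin n) (Fin n) ℂ) E)]

/-- Continuity of a section of `E`, at a point. -/
def SectionContinuousAt (s : ∀ t, E t) (t : X) : Prop :=
  ContinuousAt (fun t => (⟨t, s t⟩ : TotalSpace (Matrix (Fin n) (Fin n) ℂ) E)) t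

variable {E}

theorem sectionContinuousAt_iff {e : Trivialization (Matrix (Fin n) (Fin n) ℂ)
    (π (Matrix (Fin n) (Fin n) ℂ) E)} {t : X} (ht : t ∈ e.baseSet) (s : ∀ t, E t) :
    SectionContinuousAt n E s t ↔ ContinuousAt (fun u => (e ⟨u, s u⟩).2) t := by
  constructor
  · intro h
    have h1 : ContinuousAt e (⟨t, s t⟩ : TotalSpace (Matrix (Fin n) (Fin n) ℂ) E) :=
      e.continuousAt (e.mem_source.2 ht)
    exact continuousAt_snd.comp (ContinuousAt.comp (f := fun u =>
      (⟨u, s u⟩ : TotalSpace (Matrix (Fin n) (Fin n) ℂ) E)) h1 h)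
  · intro h
    refine e.continuousAt_of_comp_left (f := fun u =>
      (⟨u, s u⟩ : TotalSpace (Matrix (Fin n) (Fin n) ℂ) E)) continuousAt_id ht ?_
    have h2 : ContinuousAt (fun u => (u, (e ⟨u, s u⟩).2)) t := continuousAt_id.prodMk h
    refine h2.congr ?_
    filter_upwards [e.open_baseSet.mem_nhds ht] with u hu
    refine Prod.ext ?_ rfl
    exact (e.coe_fst (x := (⟨u, s u⟩ : TotalSpace _ E)) (e.mem_source.2 hu)).symm

variable [∀ t, CStarAlgebra (E t)] [IsMatrixBundle n E]

/-- A fibrewise operation that becomes continuous in the local trivializations preserves continuity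
of sections. -/
theorem SectionContinuousAt.of_local {s : ∀ t, E t} {t : X}
    (h : ∀ e : Trivialization (Matrix (Fin n) (Fin n) ℂ) (π (Matrix (Fin n) (Fin n) ℂ) E),
      t ∈ e.baseSet → ∀ ψ : ∀ u ∈ e.baseSet, E u ≃⋆ₐ[ℂ] Matrix (Fin n) (Fin n) ℂ,
      (∀ u hu v, (e ⟨u, v⟩).2 = ψ u hu v) →
      ∃ f : X → Matrix (Fin n) (Fin n) ℂ, ContinuousAt f t ∧ ∀ u hu, ψ u hu (s u) = f u) :
    SectionContinuousAt n E s t := by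
  obtain ⟨e, ht, he⟩ := IsMatrixBundle.exists_trivialization (n := n) (E := E) t
  choose ψ hψ using he
  obtain ⟨f, hf, hfs⟩ := h e ht ψ hψ
  refine (sectionContinuousAt_iff n ht s).2 (hf.congr ?_)
  filter_upwards [e.open_baseSet.mem_nhds ht] with u hu
  rw [hψ u hu, hfs u hu]

variable (E)

/-- The C⋆-algebra `Γ₀(E)` of continuous sections of `E` that vanish at infinity, as a
⋆-subalgebra of the C⋆-algebra of all bounded families `(s t)ₜ`, `s t ∈ E t`, with the
supremum norm and pointwise operations. -/
noncomputable def Γ₀ : NonUnitalStarSubalgebra ℂ (lp E ∞) where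
  carrier := {s | (∀ t, SectionContinuousAt n E (s : ∀ t, E t) t) ∧
    Tendsto (fun t => ‖s t‖) (cocompact X) (𝓝 0)}
  zero_mem' := by
    refine ⟨fun t => .of_local n fun e _ ψ _ => ⟨fun _ => 0, continuousAt_const, ?_⟩, ?_⟩
    · intro u hu; simp
    · simpa using tendsto_const_nhds
  add_mem' := by
    rintro a b ⟨ha, ha'⟩ ⟨hb, hb'⟩
    refine ⟨fun t => .of_local n fun e ht ψ hψ => ⟨_, ((sectionContinuousAt_iff n ht _).1
      (ha t)).add ((sectionContinuousAt_iff n ht _).1 (hb t)), ?_⟩, ?_⟩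
    · intro u hu; simp [hψ u hu]
    · refine squeeze_zero (fun t => norm_nonneg _) (fun t => norm_add_le (a t) (b t)) ?_
      simpa using ha'.add hb'
  mul_mem' := by
    rintro a b ⟨ha, ha'⟩ ⟨hb, hb'⟩
    refine ⟨fun t => .of_local n fun e ht ψ hψ => ⟨_, ((sectionContinuousAt_iff n ht _).1
      (ha t)).mul ((sectionContinuousAt_iff n ht _).1 (hb t)), ?_⟩, ?_⟩
    · intro u hu; simp [hψ u hu, lp.infty_coeFn_mul]
    · refine squeeze_zero (fun t => norm_nonneg _) (fun t => norm_mul_le (a t) (b t)) ?_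
      simpa using ha'.mul hb'
  smul_mem' := by
    rintro c a ⟨ha, ha'⟩
    refine ⟨fun t => .of_local n fun e ht ψ hψ => ⟨_, ((sectionContinuousAt_iff n ht _).1
      (ha t)).const_smul c, ?_⟩, ?_⟩
    · intro u hu; simp [hψ u hu]
    · simpa [norm_smul] using ha'.const_mul ‖c‖
  star_mem' := by
    rintro a ⟨ha, ha'⟩
    refine ⟨fun t => .of_local n fun e ht ψ hψ => ⟨_, ((sectionContinuousAt_iff n ht _).1
      (ha t)).star, ?_⟩, ?_⟩
    · intro u hu; simp [hψ u hu, map_star]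
    · simpa using ha'


open scoped Matrix.Norms.L2Operator in
/-- `Γ₀(E)` is norm closed, hence a C⋆-algebra. -/
instance isClosed_Γ₀ : IsClosed (Γ₀ n E : Set (lp E ∞)) := by
  refine isClosed_of_closure_subset fun s hs => ?_
  have key : ∀ ε > 0, ∃ a ∈ Γ₀ n E, ∀ t, ‖s t - a t‖ < ε := by
    intro ε hε
    obtain ⟨a, ha, hd⟩ := Metric.mem_closure_iff.1 hs ε hε
    refine ⟨a, ha, fun t => ?_⟩
    rw [dist_eq_norm] at hd
    exact (lp.norm_apply_le_norm (by simp) (s - a) t).trans_lt hd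
  refine ⟨fun t => ?_, ?_⟩
  · obtain ⟨e, ht, he⟩ := IsMatrixBundle.exists_trivialization (n := n) (E := E) t
    choose ψ hψ using he
    refine (sectionContinuousAt_iff n ht _).2 ?_
    refine continuousAt_of_locally_uniform_approx_of_continuousAt fun U hU => ?_
    obtain ⟨ε, hε, hεU⟩ := Metric.mem_uniformity_dist.1 hU
    obtain ⟨a, ha, had⟩ := key ε hε
    refine ⟨e.baseSet, e.open_baseSet.mem_nhds ht, _, (sectionContinuousAt_iff n ht _).1 (ha.1 t),
      fun u hu => hεU ?_⟩
    rw [hψ u hu, hψ u hu, dist_eq_norm, ← map_sub, NonUnitalStarAlgHom.norm_map (ψ u hu)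
      (ψ u hu).injective]
    exact had u
  · rw [Metric.tendsto_nhds]
    intro ε hε
    obtain ⟨a, ha, had⟩ := key (ε / 2) (by positivity)
    filter_upwards [Metric.tendsto_nhds.1 ha.2 (ε / 2) (by positivity)] with t ht
    have h1 := norm_add_le (s t - a t) (a t)
    simp only [sub_add_cancel, dist_zero_right, norm_norm] at h1 ht ⊢
    linarith [had t]

end Sections

theorem finiteDimensional_fibre (n : ℕ) {X : Type*} [TopologicalSpace X] (E : X → Type*)
    [∀ t, CStarAlgebra (E t)] [TopologicalSpace (TotalSpace (Matrix (Fin n) (Fin n) ℂ) E)]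
    [IsMatrixBundle n E] (t : X) : FiniteDimensional ℂ (E t) := by
  obtain ⟨e, ht, he⟩ := IsMatrixBundle.exists_trivialization (n := n) (E := E) t
  obtain ⟨ψ, -⟩ := he t ht
  let f : E t →ₗ[ℂ] Matrix (Fin n) (Fin n) ℂ :=
    { toFun := ψ, map_add' := map_add ψ, map_smul' := map_smul ψ }
  exact Module.Finite.of_injective f ψ.injective

section Fibres

variable (n : ℕ) {X : Type*} [TopologicalSpace X] {E : X → Type*}
  [∀ t, CStarAlgebra (E t)] [TopologicalSpace (TotalSpace (Matrix (Fin n) (Fin n) ℂ) E)]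
  [IsMatrixBundle n E]

/-- The closed two-sided ideal `I_t = {a ∈ Γ₀(E) : a(t) = 0}`. -/
noncomputable def evalIdeal (t : X) : TwoSidedIdeal (Γ₀ n E) :=
  .mk' {a | (a : lp E ∞) t = 0} (by simp)
    (by intro x y hx hy; simp_all) (by intro x hx; simp_all)
    (by intro x y hy; simp_all [lp.infty_coeFn_mul]) (by intro x y hy; simp_all [lp.infty_coeFn_mul])

variable {n}

theorem mem_evalIdeal {t : X} {a : Γ₀ n E} : a ∈ evalIdeal n t ↔ (a : lp E ∞) t = 0 := by
  exact TwoSidedIdeal.mem_mk' _ _ _ _ _ _ _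

theorem isClosed_evalIdeal (t : X) :
    IsClosed ((evalIdeal n t : TwoSidedIdeal (Γ₀ n E)) : Set (Γ₀ n E)) := by
  refine isClosed_of_closure_subset fun a ha => mem_evalIdeal.2 ?_
  refine norm_le_zero_iff.1 (le_of_forall_pos_le_add fun ε hε => ?_)
  obtain ⟨b, hb, hd⟩ := Metric.mem_closure_iff.1 ha ε hε
  have h1 : ‖((a : lp E ∞) - (b : lp E ∞)) t‖ ≤ _ := lp.norm_apply_le_norm (by simp) _ t
  have h2 : ((a : lp E ∞) - (b : lp E ∞)) t = (a : lp E ∞) t := by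
    simp [mem_evalIdeal.1 hb]
  rw [h2] at h1
  rw [dist_eq_norm] at hd
  simpa using h1.trans hd.le

/-- An ideal-preserving operator induces an operator on each fibre `E t = Γ₀(E) / I_t`. -/
theorem IB.eval_congr {φ : Γ₀ n E →L[ℂ] Γ₀ n E} (hφ : φ ∈ IB (Γ₀ n E)) {t : X} {a b : Γ₀ n E}
    (h : (a : lp E ∞) t = (b : lp E ∞) t) : (φ a : lp E ∞) t = (φ b : lp E ∞) t := by
  have h1 := hφ _ (isClosed_evalIdeal t) (a - b) (mem_evalIdeal.2 (by simpa [sub_eq_zero] using h))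
  rw [map_sub, mem_evalIdeal] at h1
  simpa [sub_eq_zero] using h1

variable [T2Space X] [LocallyCompactSpace X]

/-- The evaluation maps `Γ₀(E) → E t` are surjective. -/
theorem exists_eval_eq (t : X) (v : E t) : ∃ a : Γ₀ n E, (a : lp E ∞) t = v := by
  classical
  obtain ⟨e, ht, he⟩ := IsMatrixBundle.exists_trivialization (n := n) (E := E) t
  choose ψ hψ using he
  obtain ⟨K, hK, htK, hKe⟩ := exists_compact_subset e.open_baseSet ht
  obtain ⟨f, hf1, hf0, hfc, hf⟩ := exists_continuous_one_zero_of_isCompact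
    (isCompact_singleton (x := t)) isOpen_interior.isClosed_compl
    (by simpa using htK)
  let s : ∀ u, E u := fun u =>
    if hu : u ∈ e.baseSet then (f u : ℂ) • (ψ u hu).symm (ψ t ht v) else 0
  have hs : ∀ u, ‖s u‖ ≤ ‖f u‖ * ‖v‖ := by
    intro u
    by_cases hu : u ∈ e.baseSet
    · have h1 := NonUnitalStarAlgHom.norm_map ((ψ t ht).trans (ψ u hu).symm)
        ((ψ t ht).trans (ψ u hu).symm).injective v
      rw [StarAlgEquiv.trans_apply] at h1
      simp only [s, hu, dite_true, norm_smul, h1, Complex.norm_real, le_refl]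
    · simp only [s, hu, dite_false, norm_zero]; positivity
  have hsb : Memℓp s ∞ := memℓp_infty ⟨‖v‖, by
    rintro _ ⟨u, rfl⟩
    refine (hs u).trans (mul_le_of_le_one_left (norm_nonneg _) ?_)
    rw [Real.norm_of_nonneg (hf u).1]; exact (hf u).2⟩
  refine ⟨⟨⟨s, hsb⟩, fun u => ?_, ?_⟩, ?_⟩
  · change SectionContinuousAt n E s u
    by_cases hu : u ∈ e.baseSet
    · refine (sectionContinuousAt_iff n hu _).2 ?_
      have h2 : ContinuousAt (fun u => (f u : ℂ) • ψ t ht v) u := by fun_prop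
      refine h2.congr ?_
      filter_upwards [e.open_baseSet.mem_nhds hu] with w hw
      simp only [hψ w hw, s, hw, dite_true, map_smul, StarAlgEquiv.apply_symm_apply]
    · refine .of_local n fun e' _ ψ' _ => ?_
      refine ⟨fun w => if hw : w ∈ e'.baseSet then ψ' w hw (s w) else 0, ?_, ?_⟩
      · refine ContinuousAt.congr (f := fun _ => 0) continuousAt_const ?_
        filter_upwards [hK.isClosed.isOpen_compl.mem_nhds fun h => hu (hKe h)] with w hw
        have h3 : f w = 0 := hf0 fun h => hw (interior_subset h)
        have h4 : s w = 0 := by simp [s, h3]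
        simp [h4]
      · intro w hw; simp [hw]
  · have h5 : Tendsto (fun u => ‖f u‖ * ‖v‖) (cocompact X) (𝓝 0) := by
      simpa using (hfc.is_zero_at_infty.norm).mul_const ‖v‖
    exact squeeze_zero (fun u => norm_nonneg _) hs h5
  · change s t = v
    have h6 : f t = 1 := hf1 rfl
    simp [s, ht, h6]

/-- The operator `φ_t` induced by `φ ∈ IB(Γ₀(E))` on the fibre `E t = Γ₀(E) / I_t`, determined by
`φ_t (a t) = (φ a) t` for all `a ∈ Γ₀(E)`. -/
noncomputable def fibreOp (φ : Γ₀ n E →L[ℂ] Γ₀ n E) (hφ : φ ∈ IB (Γ₀ n E)) (t : X) :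
    E t →L[ℂ] E t :=
  haveI := finiteDimensional_fibre n E t
  LinearMap.toContinuousLinearMap
    { toFun := fun v => (φ (exists_eval_eq (n := n) t v).choose : lp E ∞) t
      map_add' := by
        intro v w
        rw [← Pi.add_apply, ← lp.coeFn_add, ← NonUnitalStarSubalgebra.coe_add, ← map_add]
        refine IB.eval_congr hφ ?_
        simp [(exists_eval_eq (n := n) t _).choose_spec]
      map_smul' := by
        intro c v
        rw [RingHom.id_apply, ← Pi.smul_apply, ← lp.coeFn_smul, ← NonUnitalStarSubalgebra.coe_smul,
          ← map_smul]
        refine IB.eval_congr hφ ?_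
        simp [(exists_eval_eq (n := n) t _).choose_spec] }

theorem fibreOp_apply {φ : Γ₀ n E →L[ℂ] Γ₀ n E} (hφ : φ ∈ IB (Γ₀ n E)) (t : X) (a : Γ₀ n E) :
    fibreOp φ hφ t ((a : lp E ∞) t) = (φ a : lp E ∞) t :=
  IB.eval_congr hφ (exists_eval_eq (n := n) t ((a : lp E ∞) t)).choose_spec

variable (n E)

/-- `IB₁(A)`, for `A = Γ₀(E)`: the `φ ∈ IB(A)` such that each `φ_t` is a two-sided multiplication on
the fibre at `t`. -/
def IB₁ : Set (Γ₀ n E →L[ℂ] Γ₀ n E) :=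
  {φ | ∃ hφ : φ ∈ IB (Γ₀ n E), ∀ t, fibreOp φ hφ t ∈ TM (E t)}

/-- `IB₀(A)`, for `A = Γ₀(E)`: the `φ ∈ IB(A)` such that `t ↦ ‖φ_t‖` lies in `C₀(X)`. -/
def IB₀ : Set (Γ₀ n E →L[ℂ] Γ₀ n E) :=
  {φ | ∃ hφ : φ ∈ IB (Γ₀ n E), Continuous (fun t => ‖fibreOp φ hφ t‖) ∧
    Tendsto (fun t => ‖fibreOp φ hφ t‖) (cocompact X) (𝓝 0)}

/-- `IB₀,₁(A) = IB₀(A) ∩ IB₁(A)`. -/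
def IB₀₁ : Set (Γ₀ n E →L[ℂ] Γ₀ n E) := IB₀ n E ∩ IB₁ n E

end Fibres

section LineSubbundles

variable (n : ℕ) {X : Type*} {E : X → Type*} [∀ t, CStarAlgebra (E t)]

/-- The part over `U` of the total space of a family of subspaces `L t ⊆ E t`; it carries the
subspace topology of the total space of `E`. -/
def subTotal (L : ∀ t, Submodule ℂ (E t)) (U : Set X) :
    Set (TotalSpace (Matrix (Fin n) (Fin n) ℂ) E) :=
  {p | p.proj ∈ U ∧ p.snd ∈ L p.proj}

variable [TopologicalSpace X] [TopologicalSpace (TotalSpace (Matrix (Fin n) (Fin n) ℂ) E)]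

/-- The family `L` is a trivial complex line bundle over `U`: there is a homeomorphism from
`U × ℂ` onto `L|_U` that restricts, for each `t ∈ U`, to a linear isomorphism `{t} × ℂ ≃ L t`. -/
def IsTrivialLineBundleOn (L : ∀ t, Submodule ℂ (E t)) (U : Set X) : Prop :=
  ∃ ℓ : ∀ t : U, ℂ ≃ₗ[ℂ] L t, IsHomeomorph (fun p : U × ℂ =>
    (⟨⟨p.1, (ℓ p.1 p.2 : E p.1)⟩, p.1.2, (ℓ p.1 p.2).2⟩ : subTotal n L U))

/-- The family `L` (restricted to the open set `U`) is a complex line subbundle of `E|_U`, i.e. a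
locally trivial family of one-dimensional subspaces of the fibres. -/
def IsLineSubbundleOn (L : ∀ t, Submodule ℂ (E t)) (U : Set X) : Prop :=
  ∀ t ∈ U, ∃ V : Set X, IsOpen V ∧ t ∈ V ∧ V ⊆ U ∧ IsTrivialLineBundleOn n L V

end LineSubbundles

section BumpFunctions

variable {X : Type*} [TopologicalSpace X] [T2Space X] [LocallyCompactSpace X]

theorem exists_bump {K W : Set X} (hK : IsCompact K) (hW : IsOpen W) (hKW : K ⊆ W) :
    ∃ g : C(X, ℝ), (∀ t ∈ K, ∀ᶠ u in 𝓝 t, g u = 1) ∧ tsupport g ⊆ W ∧ HasCompactSupport g ∧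
      ∀ t, g t ∈ Icc (0 : ℝ) 1 := by
  obtain ⟨L, hL, hKL, hLW⟩ := exists_compact_between hK hW hKW
  obtain ⟨M, hM, hLM, hMW⟩ := exists_compact_between hL hW hLW
  obtain ⟨g, hg1, hg0, hgc, hg⟩ := exists_continuous_one_zero_of_isCompact hL
    (isOpen_interior (s := M)).isClosed_compl
    (disjoint_left.2 fun t ht ht' => ht' (hLM ht))
  refine ⟨g, fun t ht => ?_, ?_, hgc, hg⟩
  · filter_upwards [isOpen_interior.mem_nhds (hKL ht)] with u hu
    exact hg1 (interior_subset hu)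
  · refine (closure_minimal (fun t ht => ?_) hM.isClosed).trans hMW
    by_contra h
    exact ht (hg0 fun h' => h (interior_subset h'))

end BumpFunctions

open scoped Matrix.Norms.L2Operator in
theorem norm_chart {n : ℕ} {B : Type*} [CStarAlgebra B] (ψ : B ≃⋆ₐ[ℂ] Matrix (Fin n) (Fin n) ℂ)
    (v : B) : ‖ψ v‖ = ‖v‖ :=
  NonUnitalStarAlgHom.norm_map ψ ψ.injective v

section Continuity

variable {n : ℕ} {X : Type*} [TopologicalSpace X] {E : X → Type*}
  [TopologicalSpace (TotalSpace (Matrix (Fin n) (Fin n) ℂ) E)]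

theorem SectionContinuousAt.congr {s s' : ∀ t, E t} {t : X} (h : SectionContinuousAt n E s t)
    (hs : ∀ᶠ u in 𝓝 t, s u = s' u) : SectionContinuousAt n E s' t :=
  ContinuousAt.congr h (hs.mono fun u hu => by dsimp only; rw [hu])

variable [∀ t, CStarAlgebra (E t)]

theorem SectionContinuousAt.constant {e : Trivialization (Matrix (Fin n) (Fin n) ℂ)
      (π (Matrix (Fin n) (Fin n) ℂ) E)} {ψ : ∀ u ∈ e.baseSet, E u ≃⋆ₐ[ℂ] Matrix (Fin n) (Fin n) ℂ}
    (hψ : ∀ u hu v, (e ⟨u, v⟩).2 = ψ u hu v) {a : ∀ t, E t} {M : Matrix (Fin n) (Fin n) ℂ}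
    (ha : ∀ u hu, ψ u hu (a u) = M) {t : X} (ht : t ∈ e.baseSet) : SectionContinuousAt n E a t := by
  refine (sectionContinuousAt_iff n ht _).2 (ContinuousAt.congr (f := fun _ => M)
    continuousAt_const ?_)
  filter_upwards [e.open_baseSet.mem_nhds ht] with u hu
  rw [hψ u hu, ha u hu]

variable [IsMatrixBundle n E]

variable (n E) in
theorem exists_chart (t : X) : ∃ (e : Trivialization (Matrix (Fin n) (Fin n) ℂ)
      (π (Matrix (Fin n) (Fin n) ℂ) E)) (ψ : ∀ u ∈ e.baseSet, E u ≃⋆ₐ[ℂ] Matrix (Fin n) (Fin n) ℂ),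
    t ∈ e.baseSet ∧ ∀ u hu v, (e ⟨u, v⟩).2 = ψ u hu v := by
  obtain ⟨e, ht, he⟩ := IsMatrixBundle.exists_trivialization (n := n) (E := E) t
  choose ψ hψ using he
  exact ⟨e, ψ, ht, hψ⟩

theorem SectionContinuousAt.mul {a b : ∀ t, E t} {t : X} (ha : SectionContinuousAt n E a t)
    (hb : SectionContinuousAt n E b t) : SectionContinuousAt n E (fun t => a t * b t) t :=
  .of_local n fun _ ht _ hψ => ⟨_, ((sectionContinuousAt_iff n ht _).1 ha).mul
    ((sectionContinuousAt_iff n ht _).1 hb), fun u hu => by simp [hψ u hu]⟩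

theorem SectionContinuousAt.add {a b : ∀ t, E t} {t : X} (ha : SectionContinuousAt n E a t)
    (hb : SectionContinuousAt n E b t) : SectionContinuousAt n E (fun t => a t + b t) t :=
  .of_local n fun _ ht _ hψ => ⟨_, ((sectionContinuousAt_iff n ht _).1 ha).add
    ((sectionContinuousAt_iff n ht _).1 hb), fun u hu => by simp [hψ u hu]⟩

theorem SectionContinuousAt.star {a : ∀ t, E t} {t : X} (ha : SectionContinuousAt n E a t) :
    SectionContinuousAt n E (fun t => star (a t)) t :=
  .of_local n fun _ ht _ hψ => ⟨_, ((sectionContinuousAt_iff n ht _).1 ha).star,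
    fun u hu => by simp [hψ u hu, map_star]⟩

theorem SectionContinuousAt.smul {f : X → ℂ} {a : ∀ t, E t} {t : X} (hf : ContinuousAt f t)
    (ha : SectionContinuousAt n E a t) : SectionContinuousAt n E (fun t => f t • a t) t :=
  .of_local n fun _ ht _ hψ => ⟨_, hf.smul ((sectionContinuousAt_iff n ht _).1 ha),
    fun u hu => by simp [hψ u hu]⟩

variable (n E) in
theorem SectionContinuousAt.zero (t : X) : SectionContinuousAt n E (fun _ => 0) t :=
  .of_local n fun _ _ _ _ => ⟨fun _ => 0, continuousAt_const, fun u hu => by simp⟩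

variable (n E) in
theorem SectionContinuousAt.one (t : X) : SectionContinuousAt n E (fun _ => 1) t :=
  .of_local n fun _ _ _ _ => ⟨fun _ => 1, continuousAt_const, fun u hu => by simp⟩

theorem SectionContinuousAt.sum {ι : Type*} (I : Finset ι) {a : ι → ∀ t, E t} {t : X}
    (ha : ∀ i ∈ I, SectionContinuousAt n E (a i) t) :
    SectionContinuousAt n E (fun t => ∑ i ∈ I, a i t) t := by
  classical
  induction I using Finset.induction_on with
  | empty => simpa using SectionContinuousAt.zero n E t
  | insert i I hi ih =>
    simp only [Finset.sum_insert hi]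
    exact (ha i (Finset.mem_insert_self i I)).add
      (ih fun j hj => ha j (Finset.mem_insert_of_mem hj))

open scoped Matrix.Norms.L2Operator in
theorem SectionContinuousAt.norm {a : ∀ t, E t} {t : X} (ha : SectionContinuousAt n E a t) :
    ContinuousAt (fun t => ‖a t‖) t := by
  obtain ⟨e, ψ, ht, hψ⟩ := exists_chart n E t
  refine ((sectionContinuousAt_iff n ht _).1 ha).norm.congr ?_
  filter_upwards [e.open_baseSet.mem_nhds ht] with u hu
  rw [hψ u hu, norm_chart]

open scoped Matrix.Norms.L2Operator in
theorem SectionContinuousAt.of_tendsto_zero {a : ∀ t, E t} {t : X} (h0 : a t = 0)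
    (h : Tendsto (fun u => ‖a u‖) (𝓝 t) (𝓝 0)) : SectionContinuousAt n E a t := by
  obtain ⟨e, ψ, ht, hψ⟩ := exists_chart n E t
  refine (sectionContinuousAt_iff n ht _).2 ?_
  rw [ContinuousAt, hψ t ht, h0, map_zero]
  refine tendsto_zero_iff_norm_tendsto_zero.2 (h.congr' ?_)
  filter_upwards [e.open_baseSet.mem_nhds ht] with u hu
  rw [hψ u hu, norm_chart]

/-- A section that is continuous on an open set `W`, cut off by a function supported in `W`. -/
theorem SectionContinuousAt.cutoff {a : ∀ t, E t} {W : Set X}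
    (ha : ∀ t ∈ W, SectionContinuousAt n E a t) (g : C(X, ℝ)) (hg : tsupport g ⊆ W) (t : X) :
    SectionContinuousAt n E (fun t => (g t : ℂ) • a t) t := by
  by_cases ht : t ∈ tsupport g
  · exact (ha t (hg ht)).smul (by fun_prop)
  · refine (SectionContinuousAt.zero n E t).congr ?_
    filter_upwards [(isClosed_tsupport g).isOpen_compl.mem_nhds ht] with u hu
    rw [image_eq_zero_of_notMem_tsupport hu]; simp

namespace Γ₀

theorem continuousAt (x : Γ₀ n E) (t : X) : SectionContinuousAt n E (x : lp E ∞) t := x.2.1 t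

theorem tendsto_norm (x : Γ₀ n E) :
    Tendsto (fun t => ‖(x : lp E ∞) t‖) (cocompact X) (𝓝 0) := x.2.2

theorem mul_apply (x y : Γ₀ n E) (t : X) :
    ((x * y : Γ₀ n E) : lp E ∞) t = (x : lp E ∞) t * (y : lp E ∞) t := by
  simp [lp.infty_coeFn_mul]

theorem sub_apply (x y : Γ₀ n E) (t : X) :
    ((x - y : Γ₀ n E) : lp E ∞) t = (x : lp E ∞) t - (y : lp E ∞) t := by
  simp

theorem norm_apply_le (x : Γ₀ n E) (t : X) : ‖(x : lp E ∞) t‖ ≤ ‖x‖ :=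
  lp.norm_apply_le_norm (by simp) (x : lp E ∞) t

theorem norm_le {x : Γ₀ n E} {C : ℝ} (hC : 0 ≤ C) (h : ∀ t, ‖(x : lp E ∞) t‖ ≤ C) : ‖x‖ ≤ C :=
  lp.norm_le_of_forall_le hC h

theorem ext {x y : Γ₀ n E} (h : ∀ t, (x : lp E ∞) t = (y : lp E ∞) t) : x = y :=
  Subtype.ext (lp.ext (funext h))

theorem exists_of_continuous {s : ∀ t, E t} (hs : ∀ t, SectionContinuousAt n E s t)
    (hs0 : Tendsto (fun t => ‖s t‖) (cocompact X) (𝓝 0)) :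
    ∃ x : Γ₀ n E, ∀ t, (x : lp E ∞) t = s t := by
  have hb : Memℓp s ∞ := by
    obtain ⟨K, hK, hKs⟩ := (hasBasis_cocompact.eventually_iff).1 (hs0.eventually_lt_const one_pos)
    obtain ⟨C, hC⟩ := hK.bddAbove_image
      (f := fun t => ‖s t‖) fun t _ => (hs t).norm.continuousWithinAt
    refine memℓp_infty ⟨max C 1, ?_⟩
    rintro _ ⟨t, rfl⟩
    by_cases ht : t ∈ K
    · exact le_max_of_le_left (hC ⟨t, ht, rfl⟩)
    · exact le_max_of_le_right (hKs ht).le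
  exact ⟨⟨⟨s, hb⟩, hs, hs0⟩, fun t => rfl⟩

theorem exists_of_compactSupport {s : ∀ t, E t} {W : Set X}
    (hs : ∀ t ∈ W, SectionContinuousAt n E s t) (g : C(X, ℝ)) (hg : tsupport g ⊆ W)
    (hgc : HasCompactSupport g) : ∃ x : Γ₀ n E, ∀ t, (x : lp E ∞) t = (g t : ℂ) • s t := by
  refine exists_of_continuous (fun t => SectionContinuousAt.cutoff hs g hg t) ?_
  refine tendsto_const_nhds.congr' ?_
  filter_upwards [hgc.isCompact.compl_mem_cocompact] with t ht
  rw [image_eq_zero_of_notMem_tsupport ht]; simp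

variable [T2Space X] [LocallyCompactSpace X]

variable (n E) in
theorem exists_one {K : Set X} (hK : IsCompact K) {W : Set X} (hW : IsOpen W) (hKW : K ⊆ W) :
    ∃ x : Γ₀ n E, (∀ t ∈ K, ∀ᶠ u in 𝓝 t, (x : lp E ∞) u = 1) ∧ ∀ t ∉ W, (x : lp E ∞) t = 0 := by
  obtain ⟨g, hg1, hgW, hgc, hg⟩ := exists_bump hK hW hKW
  obtain ⟨x, hx⟩ := exists_of_compactSupport (n := n) (E := E)
    (fun t _ => SectionContinuousAt.one n E t) g hgW hgc
  refine ⟨x, fun t ht => (hg1 t ht).mono fun u hu => by rw [hx, hu]; simp, fun t ht => ?_⟩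
  rw [hx, image_eq_zero_of_notMem_tsupport fun h => ht (hgW h)]; simp

open scoped Matrix.Norms.L2Operator in
/-- There are elements of `Γ₀(E)` that are constant near a given point, in a given chart. -/
theorem exists_constant {e : Trivialization (Matrix (Fin n) (Fin n) ℂ)
      (π (Matrix (Fin n) (Fin n) ℂ) E)} {ψ : ∀ u ∈ e.baseSet, E u ≃⋆ₐ[ℂ] Matrix (Fin n) (Fin n) ℂ}
    (hψ : ∀ u hu v, (e ⟨u, v⟩).2 = ψ u hu v) {t : X} (ht : t ∈ e.baseSet)
    (M : Matrix (Fin n) (Fin n) ℂ) :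
    ∃ x : Γ₀ n E, ‖x‖ ≤ ‖M‖ ∧ ∀ᶠ u in 𝓝 t, ∀ hu, ψ u hu ((x : lp E ∞) u) = M := by
  classical
  obtain ⟨g, hg1, hgW, hgc, hg⟩ := exists_bump (isCompact_singleton (x := t)) e.open_baseSet
    (by simpa using ht)
  let s : ∀ u, E u := fun u => if hu : u ∈ e.baseSet then (ψ u hu).symm M else 0
  have hs : ∀ u hu, ψ u hu (s u) = M := fun u hu => by
    simp only [s, hu, dite_true, StarAlgEquiv.apply_symm_apply]
  obtain ⟨x, hx⟩ := exists_of_compactSupport (n := n) (E := E)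
    (fun t ht => SectionContinuousAt.constant hψ hs ht) g hgW hgc
  refine ⟨x, norm_le (norm_nonneg _) fun u => ?_, ?_⟩
  · rw [hx, norm_smul, Complex.norm_real, Real.norm_of_nonneg (hg u).1]
    refine (mul_le_of_le_one_left (norm_nonneg _) (hg u).2).trans ?_
    by_cases hu : u ∈ e.baseSet
    · rw [← hs u hu, norm_chart]
    · simp [s, hu]
  · filter_upwards [hg1 t rfl] with u hu hue
    rw [hx, hu, Complex.ofReal_one, one_smul, hs u hue]

open scoped Matrix.Norms.L2Operator in
theorem exists_eval_eq_norm_le (t : X) (v : E t) :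
    ∃ x : Γ₀ n E, (x : lp E ∞) t = v ∧ ‖x‖ ≤ ‖v‖ := by
  obtain ⟨e, ψ, ht, hψ⟩ := exists_chart n E t
  obtain ⟨x, hx, hx'⟩ := exists_constant hψ ht (ψ t ht v)
  exact ⟨x, (ψ t ht).injective (hx'.self_of_nhds ht), by rwa [norm_chart] at hx⟩

/-- Closed two-sided ideals of `Γ₀(E)` are determined locally. -/
theorem mem_of_forall_exists_eval_eq (I : TwoSidedIdeal (Γ₀ n E))
    (hI : IsClosed (I : Set (Γ₀ n E))) (y : Γ₀ n E)
    (h : ∀ t, ∃ x ∈ I, (x : lp E ∞) t = (y : lp E ∞) t) : y ∈ I := by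
  choose x hxI hx using h
  refine hI.closure_subset (Metric.mem_closure_iff.2 fun ε hε => ?_)
  have hε2 : 0 < ε / 2 := by positivity
  obtain ⟨K, hK, hKy⟩ := (hasBasis_cocompact.eventually_iff).1
    ((tendsto_norm y).eventually_lt_const hε2)
  let V : X → Set X := fun t => interior {u | ‖(x t : lp E ∞) u - (y : lp E ∞) u‖ < ε / 2}
  have hV : ∀ t, t ∈ V t := fun t => by
    refine mem_interior_iff_mem_nhds.2 ?_
    have h1 := (continuousAt (x t - y) t).norm
    simp only [sub_apply] at h1
    exact h1.eventually_lt_const (by simpa [hx t] using hε)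
  obtain ⟨T, hT⟩ := hK.elim_finite_subcover V (fun t => isOpen_interior)
    fun t _ => mem_iUnion.2 ⟨t, hV t⟩
  obtain ⟨f, hf, hfc⟩ := PartitionOfUnity.exists_isSubordinate_of_locallyFinite_t2space hK
    (fun t : T => V t) (fun t => isOpen_interior) (locallyFinite_of_finite _)
    (by simpa [iUnion_subtype] using hT)
  have h1 : ∀ i, ∃ z : Γ₀ n E, ∀ t, (z : lp E ∞) t = (f i t : ℂ) • (1 : E t) := fun i =>
    exists_of_compactSupport (fun t _ => SectionContinuousAt.one n E t) (f i)
      (subset_univ _) (hfc i)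
  choose z hz using h1
  refine ⟨∑ i, z i * x i, sum_mem fun i _ => I.mul_mem_left _ _ (hxI i), ?_⟩
  rw [dist_eq_norm]
  refine lt_of_le_of_lt (norm_le hε2.le fun t => ?_) (half_lt_self hε)
  have hsum : ((∑ i, z i * x i : Γ₀ n E) : lp E ∞) t = ∑ i, (f i t : ℂ) • (x i : lp E ∞) t := by
    rw [AddSubmonoidClass.coe_finsetSum, lp.coeFn_sum, Finset.sum_apply]
    exact Finset.sum_congr rfl fun i _ => by rw [mul_apply, hz, smul_one_mul]
  have hle : ∑ i, f i t ≤ 1 := by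
    simpa [finsum_eq_sum_of_fintype] using f.sum_le_one t
  have hdec : (y : lp E ∞) t - ∑ i, (f i t : ℂ) • (x i : lp E ∞) t =
      ((1 - ∑ i, f i t : ℝ) : ℂ) • (y : lp E ∞) t +
        ∑ i, (f i t : ℂ) • ((y : lp E ∞) t - (x i : lp E ∞) t) := by
    simp only [smul_sub, Finset.sum_sub_distrib, ← Finset.sum_smul]
    push_cast
    rw [sub_smul, one_smul]; abel
  have hy : (1 - ∑ i, f i t) * ‖(y : lp E ∞) t‖ ≤ (1 - ∑ i, f i t) * (ε / 2) := by
    by_cases ht : t ∈ K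
    · have : ∑ i, f i t = 1 := by
        simpa [finsum_eq_sum_of_fintype] using f.sum_eq_one ht
      rw [this]; simp
    · exact mul_le_mul_of_nonneg_left (hKy ht).le (sub_nonneg.2 hle)
  have hx' : ∀ i, f i t * ‖(y : lp E ∞) t - (x i : lp E ∞) t‖ ≤ f i t * (ε / 2) := fun i => by
    by_cases ht : f i t = 0
    · simp [ht]
    · refine mul_le_mul_of_nonneg_left ?_ (f.nonneg i t)
      rw [norm_sub_rev]
      have h2 : t ∈ V i := hf i (subset_tsupport _ ht)
      exact (mem_ofPred.1 (interior_subset h2)).le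
  rw [sub_apply, hsum, hdec]
  calc _ ≤ (1 - ∑ i, f i t) * ‖(y : lp E ∞) t‖ +
        ∑ i, f i t * ‖(y : lp E ∞) t - (x i : lp E ∞) t‖ := by
        refine (norm_add_le _ _).trans (add_le_add ?_ ((norm_sum_le _ _).trans
          (Finset.sum_le_sum fun i _ => ?_)))
        · rw [norm_smul, Complex.norm_real, Real.norm_of_nonneg (sub_nonneg.2 hle)]
        · rw [norm_smul, Complex.norm_real, Real.norm_of_nonneg (f.nonneg i t)]
    _ ≤ (1 - ∑ i, f i t) * (ε / 2) + ∑ i, f i t * (ε / 2) :=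
        add_le_add hy (Finset.sum_le_sum fun i _ => hx' i)
    _ = ε / 2 := by rw [← Finset.sum_mul]; ring

end Γ₀

end Continuity

section MatrixAlgebras

theorem ContinuousLinearMap.norm_mul_norm_le_of_forall {H : Type*} [NormedAddCommGroup H]
    [InnerProductSpace ℂ H] {a b : H →L[ℂ] H} {C : ℝ} (hC : 0 ≤ C)
    (h : ∀ x, ‖a * x * b‖ ≤ C * ‖x‖) : ‖a‖ * ‖b‖ ≤ C := by
  have h1 : ∀ ξ η, ‖a ξ‖ * ‖b η‖ ≤ C * ‖ξ‖ * ‖η‖ := by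
    intro ξ η
    by_cases hb : b η = 0
    · rw [hb, norm_zero, mul_zero]; positivity
    have h2 := (le_opNorm (a * InnerProductSpace.rankOne ℂ ξ (b η) * b) η).trans
      (mul_le_mul_of_nonneg_right (h _) (norm_nonneg η))
    have h3 : (a * InnerProductSpace.rankOne ℂ ξ (b η) * b) η = ((‖b η‖ : ℂ) ^ 2) • a ξ := by
      simp [InnerProductSpace.rankOne_apply, inner_self_eq_norm_sq_to_K]
    rw [h3, norm_smul, norm_pow, Complex.norm_real, norm_norm,
      InnerProductSpace.norm_rankOne] at h2
    have h4 : 0 < ‖b η‖ := norm_pos_iff.2 hb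
    refine le_of_mul_le_mul_left ?_ h4
    linarith
  have h5 : ∀ η, ‖a‖ * ‖b η‖ ≤ C * ‖η‖ := by
    intro η
    have h6 : ‖((‖b η‖ : ℂ)) • a‖ ≤ C * ‖η‖ := opNorm_le_bound _ (by positivity) fun ξ => by
      rw [smul_apply, norm_smul, Complex.norm_real, norm_norm]
      linarith [h1 ξ η]
    rw [norm_smul, Complex.norm_real, norm_norm] at h6
    linarith
  have h7 : ‖((‖a‖ : ℂ)) • b‖ ≤ C := opNorm_le_bound _ hC fun η => by
    rw [smul_apply, norm_smul, Complex.norm_real, norm_norm]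
    exact h5 η
  rwa [norm_smul, Complex.norm_real, norm_norm] at h7

theorem Matrix.sum_mul_single_mul_mul_single {ι R : Type*} [Fintype ι] [DecidableEq ι] [CommRing R]
    (a b : Matrix ι ι R) (j k : ι) :
    ∑ i, a * Matrix.single i j 1 * b * Matrix.single k i 1 = b j k • a := by
  have h : ∀ i, a * Matrix.single i j 1 * b * Matrix.single k i 1 =
      a * Matrix.single i i (b j k) := fun i => by
    rw [mul_assoc, mul_assoc, ← mul_assoc (Matrix.single i j 1), Matrix.single_mul_mul_single]
    simp
  simp only [h, ← Finset.mul_sum]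
  rw [show ∑ i, Matrix.single i i (b j k) = b j k • (1 : Matrix ι ι R) by
    rw [Matrix.smul_one_eq_diagonal, ← Matrix.sum_single_eq_diagonal], mul_smul_comm, mul_one]

theorem Matrix.sum_single_mul_mul_single_mul {ι R : Type*} [Fintype ι] [DecidableEq ι] [CommRing R]
    (a b : Matrix ι ι R) (j k : ι) :
    ∑ i, Matrix.single i j 1 * (a * Matrix.single k i 1 * b) = a j k • b := by
  have h : ∀ i, Matrix.single i j 1 * (a * Matrix.single k i 1 * b) =
      Matrix.single i i (a j k) * b := fun i => by
    rw [← mul_assoc, ← mul_assoc, Matrix.single_mul_mul_single]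
    simp
  simp only [h, ← Finset.sum_mul]
  rw [show ∑ i, Matrix.single i i (a j k) = a j k • (1 : Matrix ι ι R) by
    rw [Matrix.smul_one_eq_diagonal, ← Matrix.sum_single_eq_diagonal], smul_one_mul]

theorem Matrix.exists_apply_ne_zero {ι R : Type*} [Zero R] {a : Matrix ι ι R} (ha : a ≠ 0) :
    ∃ j k, a j k ≠ 0 := by
  by_contra! h
  exact ha (Matrix.ext h)

variable {n : ℕ} {B : Type*} [CStarAlgebra B]

open scoped Matrix.Norms.L2Operator in
theorem norm_mul_norm_le_of_forall_norm_le (ψ : B ≃⋆ₐ[ℂ] Matrix (Fin n) (Fin n) ℂ)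
    {a b : B} {C : ℝ} (hC : 0 ≤ C)
    (h : ∀ x, ‖a * x * b‖ ≤ C * ‖x‖) : ‖a‖ * ‖b‖ ≤ C := by
  have hn : ∀ y : B, ‖Matrix.toEuclideanCLM (n := Fin n) (𝕜 := ℂ) (ψ y)‖ = ‖y‖ := fun y => by
    rw [← norm_chart ψ y]; rfl
  have h1 := ContinuousLinearMap.norm_mul_norm_le_of_forall
    (a := Matrix.toEuclideanCLM (n := Fin n) (𝕜 := ℂ) (ψ a))
    (b := Matrix.toEuclideanCLM (n := Fin n) (𝕜 := ℂ) (ψ b)) hC fun x => by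
      obtain ⟨y, rfl⟩ : ∃ y, Matrix.toEuclideanCLM (n := Fin n) (𝕜 := ℂ) (ψ y) = x :=
        ⟨ψ.symm ((Matrix.toEuclideanCLM (n := Fin n) (𝕜 := ℂ)).symm x), by simp⟩
      rw [← map_mul, ← map_mul, ← map_mul, ← map_mul, hn, hn]
      exact h y
  rwa [hn, hn] at h1

theorem eq_zero_or_eq_zero_of_forall_mul_mul_eq_zero (ψ : B ≃⋆ₐ[ℂ] Matrix (Fin n) (Fin n) ℂ)
    {a b : B} (h : ∀ x, a * x * b = 0) :
    a = 0 ∨ b = 0 := by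
  have h1 : ‖a‖ * ‖b‖ ≤ 0 := norm_mul_norm_le_of_forall_norm_le ψ le_rfl fun x => by simp [h x]
  have h2 := le_antisymm h1 (by positivity)
  simpa using h2

theorem exists_eq_smul_of_forall_mul_mul_eq (ψ : B ≃⋆ₐ[ℂ] Matrix (Fin n) (Fin n) ℂ)
    {a b a' b' : B} (h : ∀ x, a * x * b = a' * x * b')
    (hb : b ≠ 0) : ∃ c : ℂ, a = c • a' := by
  obtain ⟨j, k, hjk⟩ := Matrix.exists_apply_ne_zero
    ((map_ne_zero_iff ψ (EquivLike.injective ψ)).2 hb)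
  refine ⟨(ψ b j k)⁻¹ * ψ b' j k, EquivLike.injective ψ ?_⟩
  rw [map_smul, mul_smul, ← Matrix.sum_mul_single_mul_mul_single (ψ a'),
    eq_inv_smul_iff₀ hjk, ← Matrix.sum_mul_single_mul_mul_single (ψ a)]
  refine Finset.sum_congr rfl fun i _ => ?_
  have h1 := congrArg ψ (h (ψ.symm (Matrix.single i j 1)))
  simp only [map_mul, StarAlgEquiv.apply_symm_apply] at h1
  rw [h1]

end MatrixAlgebras

section FibrewiseMultiplications

variable {n : ℕ} {X : Type*} [TopologicalSpace X] {E : X → Type*}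
  [∀ t, CStarAlgebra (E t)] [TopologicalSpace (TotalSpace (Matrix (Fin n) (Fin n) ℂ) E)]
  [IsMatrixBundle n E]

/-- The operator `φ` on `Γ₀(E)` is given by the two-sided multiplications `v ↦ a t * v * b t` on
the fibres; no continuity of `a` and `b` is assumed. -/
def IsMulBy (φ : Γ₀ n E →L[ℂ] Γ₀ n E) (a b : ∀ t, E t) : Prop :=
  ∀ (x : Γ₀ n E) (t : X), (φ x : lp E ∞) t = a t * (x : lp E ∞) t * b t

theorem Γ₀.exists_continuousLinearMap (T : ∀ t, E t →ₗ[ℂ] E t) {C : ℝ} (hC : 0 ≤ C)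
    (hTC : ∀ t v, ‖T t v‖ ≤ C * ‖v‖)
    (hT : ∀ (x : Γ₀ n E) t, SectionContinuousAt n E (fun t => T t ((x : lp E ∞) t)) t) :
    ∃ φ : Γ₀ n E →L[ℂ] Γ₀ n E, ∀ x t, (φ x : lp E ∞) t = T t ((x : lp E ∞) t) := by
  have h1 : ∀ x : Γ₀ n E, ∃ y : Γ₀ n E, ∀ t, (y : lp E ∞) t = T t ((x : lp E ∞) t) := fun x => by
    refine exists_of_continuous (hT x) (squeeze_zero (fun t => norm_nonneg _)
      (fun t => hTC t _) ?_)
    simpa using (tendsto_norm x).const_mul C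
  choose f hf using h1
  let g : Γ₀ n E →ₗ[ℂ] Γ₀ n E :=
    { toFun := f
      map_add' := fun x y => Γ₀.ext fun t => by simp [hf]
      map_smul' := fun c x => Γ₀.ext fun t => by simp [hf] }
  refine ⟨g.mkContinuous C fun x => norm_le (by positivity) fun t => ?_, hf⟩
  exact (congrArg norm (hf x t)).le.trans ((hTC t _).trans
    (mul_le_mul_of_nonneg_left (norm_apply_le x t) hC))

theorem Γ₀.exists_multiplier {a : ∀ t, E t} (ha : ∀ t, SectionContinuousAt n E a t) {C : ℝ}
    (hC : 0 ≤ C) (haC : ∀ t, ‖a t‖ ≤ C) :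
    ∃ m : 𝓜(ℂ, Γ₀ n E), ∀ x t, (m.fst x : lp E ∞) t = a t * (x : lp E ∞) t ∧
      (m.snd x : lp E ∞) t = (x : lp E ∞) t * a t := by
  obtain ⟨l, hl⟩ := exists_continuousLinearMap (n := n) (fun t => LinearMap.mulLeft ℂ (a t)) hC
    (fun t v => (norm_mul_le _ _).trans (mul_le_mul_of_nonneg_right (haC t) (norm_nonneg v)))
    fun x t => (ha t).mul (continuousAt x t)
  obtain ⟨r, hr⟩ := exists_continuousLinearMap (n := n) (fun t => LinearMap.mulRight ℂ (a t)) hC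
    (fun t v => (norm_mul_le _ _).trans (by
      rw [mul_comm]; exact mul_le_mul_of_nonneg_right (haC t) (norm_nonneg v)))
    fun x t => (continuousAt x t).mul (ha t)
  refine ⟨⟨(l, r), fun x y => Γ₀.ext fun t => ?_⟩, fun x t => ⟨hl x t, hr x t⟩⟩
  simp only [mul_apply, hl, hr, LinearMap.mulLeft_apply, LinearMap.mulRight_apply, mul_assoc]

theorem IsMulBy.mem_TM {φ : Γ₀ n E →L[ℂ] Γ₀ n E} {a b : ∀ t, E t} (h : IsMulBy φ a b)
    (ha : ∀ t, SectionContinuousAt n E a t) (hb : ∀ t, SectionContinuousAt n E b t) {C : ℝ}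
    (hC : 0 ≤ C) (haC : ∀ t, ‖a t‖ ≤ C) (hbC : ∀ t, ‖b t‖ ≤ C) : φ ∈ TM (Γ₀ n E) := by
  obtain ⟨m, hm⟩ := Γ₀.exists_multiplier ha hC haC
  obtain ⟨k, hk⟩ := Γ₀.exists_multiplier hb hC hbC
  refine ⟨m, k, ContinuousLinearMap.ext fun x => Γ₀.ext fun t => ?_⟩
  change _ = (m.fst (k.snd x) : lp E ∞) t
  rw [(hm _ t).1, (hk _ t).2, h x t, mul_assoc]

theorem mem_TM₀_iff {φ : Γ₀ n E →L[ℂ] Γ₀ n E} :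
    φ ∈ TM₀ (Γ₀ n E) ↔ ∃ a b : Γ₀ n E, IsMulBy φ (a : lp E ∞) (b : lp E ∞) := by
  refine exists_congr fun a => exists_congr fun b => ⟨fun h x t => ?_, fun h x => Γ₀.ext fun t => ?_⟩
  · rw [h x, Γ₀.mul_apply, Γ₀.mul_apply]
  · rw [h x t, Γ₀.mul_apply, Γ₀.mul_apply]

variable [T2Space X] [LocallyCompactSpace X]

theorem Γ₀.exists_section_of_multiplier (m : 𝓜(ℂ, Γ₀ n E)) :
    ∃ a : ∀ t, E t, (∀ t, SectionContinuousAt n E a t) ∧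
      ∀ x t, (m.fst x : lp E ∞) t = a t * (x : lp E ∞) t ∧
        (m.snd x : lp E ∞) t = (x : lp E ∞) t * a t := by
  choose z hz using fun t => exists_eval_eq (n := n) t (1 : E t)
  have hl : ∀ x t, (m.fst x : lp E ∞) t = (m.snd (z t) : lp E ∞) t * (x : lp E ∞) t := by
    intro x t
    rw [← mul_apply, m.central, mul_apply, hz, one_mul]
  refine ⟨fun t => (m.snd (z t) : lp E ∞) t, fun t => ?_, fun x t => ⟨hl x t, ?_⟩⟩
  · obtain ⟨w, hw, -⟩ := exists_one n E (isCompact_singleton (x := t)) isOpen_univ (subset_univ _)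
    refine (continuousAt (m.fst w) t).congr ((hw t rfl).mono fun u hu => ?_)
    rw [hl, hu, mul_one]
  · have h1 := hl (z t) t
    rw [hz, mul_one] at h1
    dsimp only
    rw [← h1, ← mul_apply, ← m.central, mul_apply, hz, mul_one]

theorem exists_isMulBy_of_mem_TM {φ : Γ₀ n E →L[ℂ] Γ₀ n E} (h : φ ∈ TM (Γ₀ n E)) :
    ∃ a b : ∀ t, E t, IsMulBy φ a b ∧ (∀ t, SectionContinuousAt n E a t) ∧
      ∀ t, SectionContinuousAt n E b t := by
  obtain ⟨m, k, rfl⟩ := h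
  obtain ⟨a, ha, hm⟩ := Γ₀.exists_section_of_multiplier m
  obtain ⟨b, hb, hk⟩ := Γ₀.exists_section_of_multiplier k
  refine ⟨a, b, fun x t => ?_, ha, hb⟩
  change (m.fst (k.snd x) : lp E ∞) t = _
  rw [(hm _ t).1, (hk _ t).2, mul_assoc]

namespace IsMulBy

variable {φ : Γ₀ n E →L[ℂ] Γ₀ n E} {a b : ∀ t, E t}

theorem mem_IB (h : IsMulBy φ a b) : φ ∈ IB (Γ₀ n E) := fun I hI x hx => by
  refine Γ₀.mem_of_forall_exists_eval_eq I hI _ fun t => ?_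
  obtain ⟨y, hy⟩ := exists_eval_eq (n := n) t (a t)
  obtain ⟨z, hz⟩ := exists_eval_eq (n := n) t (b t)
  exact ⟨y * x * z, I.mul_mem_right _ _ (I.mul_mem_left _ _ hx), by
    rw [h x t, Γ₀.mul_apply, Γ₀.mul_apply, hy, hz]⟩

theorem fibreOp_eq (h : IsMulBy φ a b) (hφ : φ ∈ IB (Γ₀ n E)) (t : X) (v : E t) :
    fibreOp φ hφ t v = a t * v * b t := by
  obtain ⟨x, rfl⟩ := exists_eval_eq (n := n) t v
  rw [fibreOp_apply, h x t]

theorem norm_fibreOp (h : IsMulBy φ a b) (hφ : φ ∈ IB (Γ₀ n E)) (t : X) :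
    ‖fibreOp φ hφ t‖ = ‖a t‖ * ‖b t‖ := by
  refine le_antisymm (ContinuousLinearMap.opNorm_le_bound _ (by positivity) fun v => ?_) ?_
  · rw [h.fibreOp_eq]
    calc ‖a t * v * b t‖ ≤ ‖a t‖ * ‖v‖ * ‖b t‖ :=
          (norm_mul_le _ _).trans (mul_le_mul_of_nonneg_right (norm_mul_le _ _) (norm_nonneg _))
      _ = _ := by ring
  · obtain ⟨e, ψ, ht, -⟩ := exists_chart n E t
    refine norm_mul_norm_le_of_forall_norm_le (ψ t ht) (norm_nonneg _) fun v => ?_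
    rw [← h.fibreOp_eq hφ]
    exact ContinuousLinearMap.le_opNorm _ v

theorem norm_mul_norm_le (h : IsMulBy φ a b) (t : X) : ‖a t‖ * ‖b t‖ ≤ ‖φ‖ := by
  obtain ⟨e, ψ, ht, -⟩ := exists_chart n E t
  refine norm_mul_norm_le_of_forall_norm_le (ψ t ht) φ.opNorm_nonneg fun v => ?_
  obtain ⟨x, rfl, hx⟩ := Γ₀.exists_eval_eq_norm_le (n := n) t v
  rw [← h x t]
  exact (Γ₀.norm_apply_le _ t).trans ((φ.le_opNorm x).trans
    (mul_le_mul_of_nonneg_left hx φ.opNorm_nonneg))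

end IsMulBy

theorem mem_IB₁_iff {φ : Γ₀ n E →L[ℂ] Γ₀ n E} :
    φ ∈ IB₁ n E ↔ ∃ a b : ∀ t, E t, IsMulBy φ a b := by
  constructor
  · rintro ⟨hφ, h⟩
    choose m k hmk using h
    refine ⟨fun t => (m t).snd 1, fun t => (k t).fst 1, fun x t => ?_⟩
    rw [← fibreOp_apply hφ, hmk]
    change (m t).fst ((k t).snd _) = _
    rw [← one_mul ((m t).fst _), ← (m t).central, ← mul_one ((k t).snd _), (k t).central, mul_assoc]
  · rintro ⟨a, b, h⟩
    refine ⟨h.mem_IB, fun t => ⟨(a t : 𝓜(ℂ, E t)), (b t : 𝓜(ℂ, E t)),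
      ContinuousLinearMap.ext fun v => ?_⟩⟩
    rw [h.fibreOp_eq, mul_assoc]
    rfl

namespace IsMulBy

variable {φ : Γ₀ n E →L[ℂ] Γ₀ n E} {a b : ∀ t, E t}

theorem exists_chart_matrix_units (h : IsMulBy φ a b) (t : X) :
    ∃ (e : Trivialization (Matrix (Fin n) (Fin n) ℂ) (π (Matrix (Fin n) (Fin n) ℂ) E))
      (ψ : ∀ u ∈ e.baseSet, E u ≃⋆ₐ[ℂ] Matrix (Fin n) (Fin n) ℂ)
      (x : Fin n → Fin n → Γ₀ n E), t ∈ e.baseSet ∧ (∀ u hu v, (e ⟨u, v⟩).2 = ψ u hu v) ∧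
      ∀ᶠ u in 𝓝 t, ∀ hu,
        (∀ j k, ∑ i, (φ (x i j) : lp E ∞) u * (x k i : lp E ∞) u = ψ u hu (b u) j k • a u) ∧
        ∀ j k, ∑ i, (x i j : lp E ∞) u * (φ (x k i) : lp E ∞) u = ψ u hu (a u) j k • b u := by
  obtain ⟨e, ψ, ht, hψ⟩ := exists_chart n E t
  choose x _ hx using fun i j => Γ₀.exists_constant hψ ht (Matrix.single i j (1 : ℂ))
  refine ⟨e, ψ, x, ht, hψ, ?_⟩
  filter_upwards [eventually_all.2 fun i => eventually_all.2 fun j => hx i j] with u hu hue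
  refine ⟨fun j k => ?_, fun j k => ?_⟩
  · refine EquivLike.injective (ψ u hue) ?_
    rw [map_smul, ← Matrix.sum_mul_single_mul_mul_single, map_sum]
    exact Finset.sum_congr rfl fun i _ => by
      rw [h, map_mul, map_mul, map_mul, hu i j hue, hu k i hue]
  · refine EquivLike.injective (ψ u hue) ?_
    rw [map_smul, ← Matrix.sum_single_mul_mul_single_mul, map_sum]
    exact Finset.sum_congr rfl fun i _ => by
      rw [h, map_mul, map_mul, map_mul, hu i j hue, hu k i hue]

theorem exists_local_section (h : IsMulBy φ a b) {t : X} (ha : a t ≠ 0) (hb : b t ≠ 0) :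
    ∃ s : ∀ t, E t, ∀ᶠ u in 𝓝 t, SectionContinuousAt n E s u ∧ s u ≠ 0 ∧ ∃ c : ℂ, s u = c • a u := by
  obtain ⟨e, ψ, x, ht, hψ, hx⟩ := h.exists_chart_matrix_units t
  obtain ⟨j, k, hjk⟩ := Matrix.exists_apply_ne_zero
    ((map_ne_zero_iff (ψ t ht) (EquivLike.injective (ψ t ht))).2 hb)
  let s : ∀ u, E u := fun u => ∑ i, (φ (x i j) : lp E ∞) u * (x k i : lp E ∞) u
  have hs : ∀ u, SectionContinuousAt n E s u := fun u => SectionContinuousAt.sum _ fun i _ =>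
    (Γ₀.continuousAt _ u).mul (Γ₀.continuousAt _ u)
  have hst : s t ≠ 0 := by
    rw [show s t = _ from (hx.self_of_nhds ht).1 j k]
    exact smul_ne_zero hjk ha
  refine ⟨s, ?_⟩
  filter_upwards [hx, e.open_baseSet.mem_nhds ht,
    (hs t).norm.eventually_ne (norm_ne_zero_iff.2 hst)] with u hu hue hsu
  exact ⟨hs u, norm_ne_zero_iff.1 hsu, _, (hu hue).1 j k⟩

theorem continuousAt_right (h : IsMulBy φ a b) {t : X} (ha : SectionContinuousAt n E a t)
    (hat : a t ≠ 0) : SectionContinuousAt n E b t := by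
  obtain ⟨e, ψ, x, ht, hψ, hx⟩ := h.exists_chart_matrix_units t
  obtain ⟨j, k, hjk⟩ := Matrix.exists_apply_ne_zero
    ((map_ne_zero_iff (ψ t ht) (EquivLike.injective (ψ t ht))).2 hat)
  have h1 : ContinuousAt (fun u => (e ⟨u, a u⟩).2 j k) t :=
    (continuous_apply_apply j k).continuousAt.comp ((sectionContinuousAt_iff n ht _).1 ha)
  have h2 : SectionContinuousAt n E
      (fun u => ∑ i, (x i j : lp E ∞) u * (φ (x k i) : lp E ∞) u) t :=
    SectionContinuousAt.sum _ fun i _ => (Γ₀.continuousAt _ t).mul (Γ₀.continuousAt _ t)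
  have h3 : (e ⟨t, a t⟩).2 j k ≠ 0 := by rwa [hψ t ht]
  refine (SectionContinuousAt.smul (h1.inv₀ h3) h2).congr ?_
  filter_upwards [hx, e.open_baseSet.mem_nhds ht, h1.eventually_ne h3] with u hu hue hau
  rw [(hu hue).2 j k, ← hψ u hue, Pi.inv_apply, inv_smul_smul₀ hau]

open scoped Matrix.Norms.L2Operator in
theorem tendsto_norm_mul_norm (h : IsMulBy φ a b) {t : X} (h0 : a t = 0 ∨ b t = 0) :
    Tendsto (fun u => ‖a u‖ * ‖b u‖) (𝓝 t) (𝓝 0) := by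
  obtain ⟨e, ψ, x, ht, hψ, hx⟩ := h.exists_chart_matrix_units t
  have h1 : Tendsto (fun u => ∑ j, ∑ k, (∑ i, ‖(φ (x i j) : lp E ∞) u‖ * ‖(x k i : lp E ∞) u‖) *
      ‖Matrix.single j k (1 : ℂ)‖) (𝓝 t) (𝓝 0) := by
    have h2 : ∀ i j, (φ (x i j) : lp E ∞) t = 0 := fun i j => by
      rw [h]; rcases h0 with h0 | h0 <;> simp [h0]
    have h3 : ContinuousAt (fun u => ∑ j, ∑ k, (∑ i, ‖(φ (x i j) : lp E ∞) u‖ *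
        ‖(x k i : lp E ∞) u‖) * ‖Matrix.single j k (1 : ℂ)‖) t :=
      tendsto_finsetSum _ fun j _ => tendsto_finsetSum _ fun k _ => Tendsto.mul_const _
        (tendsto_finsetSum _ fun i _ => (Γ₀.continuousAt _ t).norm.mul (Γ₀.continuousAt _ t).norm)
    simpa [ContinuousAt, h2] using h3
  refine squeeze_zero' (Eventually.of_forall fun u => by positivity) ?_ h1
  filter_upwards [hx, e.open_baseSet.mem_nhds ht] with u hu hue
  have h4 : ‖b u‖ ≤ ∑ j, ∑ k, ‖ψ u hue (b u) j k‖ * ‖Matrix.single j k (1 : ℂ)‖ := by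
    rw [← norm_chart (ψ u hue), Matrix.matrix_eq_sum_single (ψ u hue (b u))]
    refine (norm_sum_le _ _).trans (Finset.sum_le_sum fun j _ => (norm_sum_le _ _).trans
      (Finset.sum_le_sum fun k _ => ?_))
    rw [← Matrix.matrix_eq_sum_single, ← norm_smul, Matrix.smul_single, smul_eq_mul, mul_one]
  refine (mul_le_mul_of_nonneg_left h4 (norm_nonneg _)).trans ?_
  simp only [Finset.mul_sum]
  refine Finset.sum_le_sum fun j _ => Finset.sum_le_sum fun k _ => ?_
  rw [← mul_assoc]
  refine mul_le_mul_of_nonneg_right ?_ (norm_nonneg _)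
  rw [mul_comm, ← norm_smul, ← (hu hue).1 j k]
  exact (norm_sum_le _ _).trans (Finset.sum_le_sum fun i _ => norm_mul_le _ _)

/-- The coefficients of a fibrewise two-sided multiplication can be rescaled so as to have the same
norm; this makes them continuous at the zeros of the operator. -/
theorem exists_rescale (h : IsMulBy φ a b)
    (hab : ∀ t, a t ≠ 0 → b t ≠ 0 → SectionContinuousAt n E a t ∧ SectionContinuousAt n E b t) :
    ∃ a' b' : ∀ t, E t, IsMulBy φ a' b' ∧ (∀ t, SectionContinuousAt n E a' t) ∧
      (∀ t, SectionContinuousAt n E b' t) ∧ (∀ t, ‖a' t‖ = √(‖a t‖ * ‖b t‖)) ∧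
      ∀ t, ‖b' t‖ = √(‖a t‖ * ‖b t‖) := by
  let r : X → ℝ := fun t => √(‖a t‖ * ‖b t‖)
  have hr0 : ∀ t, a t = 0 ∨ b t = 0 → r t = 0 := fun t ht => by
    rcases ht with ht | ht <;> simp [r, ht]
  have hnorm : ∀ (c : ∀ t, E t) (t), (a t ≠ 0 → b t ≠ 0 → c t ≠ 0) →
      ‖((r t / ‖c t‖ : ℝ) : ℂ) • c t‖ = r t := fun c t hc => by
    by_cases ht : a t = 0 ∨ b t = 0
    · simp [hr0 t ht]
    · push Not at ht
      have := norm_ne_zero_iff.2 (hc ht.1 ht.2)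
      rw [norm_smul, Complex.norm_real, Real.norm_of_nonneg (by positivity), div_mul_cancel₀ _ this]
  have hcont : ∀ (c : ∀ t, E t) (_ : ∀ t, a t ≠ 0 → b t ≠ 0 → c t ≠ 0)
      (_ : ∀ t, a t ≠ 0 → b t ≠ 0 → SectionContinuousAt n E c t) (t),
      SectionContinuousAt n E (fun t => ((r t / ‖c t‖ : ℝ) : ℂ) • c t) t := fun c hc0 hc t => by
    by_cases ht : a t = 0 ∨ b t = 0
    · refine .of_tendsto_zero (by simp [hr0 t ht]) ?_
      simp only [hnorm c _ (hc0 _)]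
      simpa only [Real.sqrt_zero] using (h.tendsto_norm_mul_norm ht).sqrt
    · push Not at ht
      obtain ⟨h1, h2⟩ := hab t ht.1 ht.2
      have h3 := hc t ht.1 ht.2
      refine .smul ?_ h3
      exact Complex.continuous_ofReal.continuousAt.comp
        ((h1.norm.mul h2.norm).sqrt.div h3.norm (norm_ne_zero_iff.2 (hc0 t ht.1 ht.2)))
  refine ⟨_, _, fun x t => ?_, hcont a (fun t ha _ => ha) fun t ha hb => (hab t ha hb).1,
    hcont b (fun t _ hb => hb) fun t ha hb => (hab t ha hb).2,
    fun t => hnorm a t fun ha _ => ha, fun t => hnorm b t fun _ hb => hb⟩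
  rw [h x t]
  by_cases ht : a t = 0 ∨ b t = 0
  · rcases ht with ht | ht <;> simp [ht]
  · push Not at ht
    have h1 := norm_ne_zero_iff.2 ht.1
    have h2 := norm_ne_zero_iff.2 ht.2
    have h3 : r t / ‖b t‖ * (r t / ‖a t‖) = 1 := by
      rw [div_mul_div_comm, Real.mul_self_sqrt (by positivity), mul_comm]
      field_simp
    rw [smul_mul_assoc, smul_mul_assoc, mul_smul_comm, smul_comm, smul_smul, ← Complex.ofReal_mul,
      h3, Complex.ofReal_one, one_smul]

end IsMulBy

end FibrewiseMultiplications

section LineBundles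

variable {n : ℕ} {X : Type*} [TopologicalSpace X] {E : X → Type*}
  [∀ t, CStarAlgebra (E t)] [TopologicalSpace (TotalSpace (Matrix (Fin n) (Fin n) ℂ) E)]
  {L : ∀ t, Submodule ℂ (E t)} {U : Set X}

theorem IsTrivialLineBundleOn.exists_section (hU : IsOpen U) (h : IsTrivialLineBundleOn n L U) :
    ∃ s : ∀ t, E t, ∀ t ∈ U, SectionContinuousAt n E s t ∧ s t ≠ 0 ∧ L t = ℂ ∙ s t := by
  classical
  obtain ⟨ℓ, hℓ⟩ := h
  refine ⟨fun t => if ht : t ∈ U then ℓ ⟨t, ht⟩ 1 else 0, fun t ht => ⟨?_, ?_, ?_⟩⟩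
  · refine (continuousOn_iff_continuous_domRestrict.2 ?_ : ContinuousOn _ U).continuousAt
      (hU.mem_nhds ht)
    refine (continuous_subtype_val.comp (hℓ.continuous.comp
      (Continuous.prodMk_left (1 : ℂ)))).congr fun u => ?_
    simp
  · simp [ht]
  · simp only [ht, dite_true]
    ext v
    rw [Submodule.mem_span_singleton]
    constructor
    · intro hv
      refine ⟨(ℓ ⟨t, ht⟩).symm ⟨v, hv⟩, ?_⟩
      rw [← Submodule.coe_smul, ← map_smul, smul_eq_mul, mul_one, LinearEquiv.apply_symm_apply]
    · rintro ⟨c, rfl⟩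
      exact Submodule.smul_mem _ _ (ℓ ⟨t, ht⟩ 1).2

variable [IsMatrixBundle n E]

theorem isTrivialLineBundleOn_of_section {s : ∀ t, E t}
    (hs : ∀ t ∈ U, SectionContinuousAt n E s t ∧ s t ≠ 0 ∧ L t = ℂ ∙ s t) :
    IsTrivialLineBundleOn n L U := by
  let ℓ : ∀ t : U, ℂ ≃ₗ[ℂ] L t := fun t =>
    (LinearEquiv.toSpanNonzeroSingleton ℂ (E t) (s t) (hs t t.2).2.1).trans
      (LinearEquiv.ofEq _ _ (hs t t.2).2.2.symm)
  have hℓ : ∀ (t : U) c, (ℓ t c : E t) = c • s t := fun t c => rfl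
  have hbij : ∀ p : subTotal n L U, (ℓ ⟨p.1.proj, p.2.1⟩ ((ℓ ⟨p.1.proj, p.2.1⟩).symm
      ⟨p.1.snd, p.2.2⟩) : E p.1.proj) = p.1.snd := fun p => by
    rw [LinearEquiv.apply_symm_apply]
  let F : (U × ℂ) ≃ subTotal n L U :=
    { toFun := fun p => ⟨⟨p.1, (ℓ p.1 p.2 : E p.1)⟩, p.1.2, (ℓ p.1 p.2).2⟩
      invFun := fun p => (⟨p.1.proj, p.2.1⟩, (ℓ ⟨p.1.proj, p.2.1⟩).symm ⟨p.1.snd, p.2.2⟩)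
      left_inv := fun p => Prod.ext rfl (LinearEquiv.symm_apply_apply _ _)
      right_inv := fun p => Subtype.ext (by
        dsimp only
        rw [hbij p]) }
  refine ⟨ℓ, (Homeomorph.mk F ?_ ?_).isHomeomorph⟩
  · refine Continuous.subtype_mk (f := fun p : U × ℂ =>
      (⟨p.1, (ℓ p.1 p.2 : E p.1)⟩ : TotalSpace (Matrix (Fin n) (Fin n) ℂ) E))
      (continuous_iff_continuousAt.2 fun p => ?_) _
    obtain ⟨e, ψ, ht, hψ⟩ := exists_chart n E (p.1 : X)
    have hp : ContinuousAt (fun p : U × ℂ => (p.1 : X)) p :=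
      (continuous_subtype_val.comp continuous_fst).continuousAt
    refine e.continuousAt_of_comp_left hp ht ?_
    have h1 : ContinuousAt (fun q : U × ℂ => q.2 • (e ⟨q.1, s q.1⟩).2) p :=
      continuousAt_snd.smul (ContinuousAt.comp (f := fun q : U × ℂ => (q.1 : X))
        (g := fun u => (e ⟨u, s u⟩).2) ((sectionContinuousAt_iff n ht _).1 (hs p.1 p.1.2).1) hp)
    refine (hp.prodMk h1).congr ?_
    filter_upwards [hp.eventually_mem (e.open_baseSet.mem_nhds ht)] with q hq
    refine Prod.ext (e.coe_fst (x := (⟨q.1, (ℓ q.1 q.2 : E q.1)⟩ : TotalSpace _ E))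
      (e.mem_source.2 hq)).symm ?_
    simp only [Function.comp, hψ _ hq, hℓ, map_smul]
  · refine continuous_iff_continuousAt.2 fun p => ?_
    have hpr : Continuous (fun q : subTotal n L U => q.1.proj) :=
      (continuous_iff_continuousAt.2 fun q : TotalSpace (Matrix (Fin n) (Fin n) ℂ) E => by
        obtain ⟨e, ψ, ht, -⟩ := exists_chart n E q.proj
        exact e.continuousAt_proj (e.mem_source.2 ht)).comp continuous_subtype_val
    refine ContinuousAt.prodMk (hpr.subtype_mk _).continuousAt ?_
    obtain ⟨e, ψ, ht, hψ⟩ := exists_chart n E p.1.proj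
    obtain ⟨j, k, hjk⟩ := Matrix.exists_apply_ne_zero
      ((map_ne_zero_iff (ψ _ ht) (EquivLike.injective (ψ _ ht))).2 (hs _ p.2.1).2.1)
    rw [← hψ] at hjk
    have h1 : ContinuousAt (fun q : subTotal n L U => (e q.1).2 j k) p :=
      (continuous_apply_apply j k).continuousAt.comp (continuousAt_snd.comp
        ((e.continuousAt (e.mem_source.2 ht)).comp continuous_subtype_val.continuousAt))
    have h2 : ContinuousAt (fun q : subTotal n L U => (e ⟨q.1.proj, s q.1.proj⟩).2 j k) p :=
      (continuous_apply_apply j k).continuousAt.comp (ContinuousAt.comp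
        (f := fun q : subTotal n L U => q.1.proj) (g := fun u => (e ⟨u, s u⟩).2)
        ((sectionContinuousAt_iff n ht _).1 (hs _ p.2.1).1) hpr.continuousAt)
    refine (h1.div h2 hjk).congr ?_
    filter_upwards [hpr.continuousAt.eventually_mem (e.open_baseSet.mem_nhds ht),
      h2.eventually_ne hjk] with q hq hq'
    have h3 : (e q.1).2 = ((ℓ ⟨q.1.proj, q.2.1⟩).symm ⟨q.1.snd, q.2.2⟩) •
        (e ⟨q.1.proj, s q.1.proj⟩).2 := by
      refine (congrArg (fun v => (e ⟨q.1.proj, v⟩).2) (hbij q).symm).trans ?_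
      rw [hψ _ hq, hψ _ hq, ← map_smul]
      rfl
    rw [Pi.div_apply, h3, Matrix.smul_apply, smul_eq_mul, mul_div_cancel_right₀ _ hq']

/-- A line subbundle over the cozero set `U` of a function `f` is the bundle of left coefficients of
an operator in `IB₀,₁`. -/
theorem IsLineSubbundleOn.exists_isMulBy (hL : IsLineSubbundleOn n L U) {f : X → ℝ} (hf : Continuous f)
    (hf1 : ∀ t, f t ∈ Icc (0 : ℝ) 1) (hf0 : ∀ t ∉ U, f t = 0) :
    ∃ (φ : Γ₀ n E →L[ℂ] Γ₀ n E) (w : ∀ t, E t),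
      IsMulBy φ (fun t => (f t : ℂ) • w t) (fun t => star (w t)) ∧
      ∀ t ∈ U, ‖w t‖ = 1 ∧ L t = ℂ ∙ w t := by
  have hloc : ∀ t ∈ U, ∃ s : ∀ t, E t, ∀ᶠ u in 𝓝 t, u ∈ U ∧ SectionContinuousAt n E s u ∧
      s u ≠ 0 ∧ L u = ℂ ∙ s u := fun t ht => by
    obtain ⟨V, hV, htV, hVU, h⟩ := hL t ht
    obtain ⟨s, hs⟩ := h.exists_section hV
    exact ⟨s, by filter_upwards [hV.mem_nhds htV] with u hu using ⟨hVU hu, hs u hu⟩⟩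
  have hw : ∀ t, ∃ w : E t, (t ∉ U → w = 0) ∧ (t ∈ U → ‖w‖ = 1 ∧ L t = ℂ ∙ w) := fun t => by
    by_cases ht : t ∈ U
    · obtain ⟨s, hs⟩ := hloc t ht
      obtain ⟨-, -, hs0, hsL⟩ := hs.self_of_nhds
      have h1 := norm_ne_zero_iff.2 hs0
      refine ⟨((‖s t‖⁻¹ : ℝ) : ℂ) • s t, fun h => absurd ht h, fun _ => ⟨?_, ?_⟩⟩
      · rw [norm_smul, Complex.norm_real, norm_inv, norm_norm, inv_mul_cancel₀ h1]
      · rw [hsL, Submodule.span_singleton_smul_eq]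
        exact IsUnit.mk0 _ (by simpa using hs0)
    · exact ⟨0, fun _ => rfl, fun h => absurd h ht⟩
  choose w hw0 hw1 using hw
  have hwn : ∀ t, ‖w t‖ ≤ 1 := fun t => by
    by_cases ht : t ∈ U
    · exact (hw1 t ht).1.le
    · simp [hw0 t ht]
  let T : ∀ t, E t →ₗ[ℂ] E t := fun t =>
    LinearMap.mulLeft ℂ ((f t : ℂ) • w t) ∘ₗ LinearMap.mulRight ℂ (star (w t))
  have hT : ∀ t v, T t v = (f t : ℂ) • w t * v * star (w t) := fun t v => by
    simp [T, mul_assoc]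
  have hTf : ∀ t v, ‖T t v‖ ≤ f t * ‖v‖ := fun t v => by
    rw [hT]
    refine (norm_mul_le _ _).trans ((mul_le_mul (norm_mul_le _ _) ((norm_star _).trans_le (hwn t))
      (norm_nonneg _) (by positivity)).trans ?_)
    rw [mul_one, norm_smul, Complex.norm_real, Real.norm_of_nonneg (hf1 t).1]
    exact mul_le_mul_of_nonneg_right (mul_le_of_le_one_right (hf1 t).1 (hwn t)) (norm_nonneg _)
  obtain ⟨φ, hφ⟩ := Γ₀.exists_continuousLinearMap (n := n) T zero_le_one
    (fun t v => (hTf t v).trans (mul_le_mul_of_nonneg_right (hf1 t).2 (norm_nonneg _)))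
    fun x t => by
      by_cases ht : t ∈ U
      · obtain ⟨s, hs⟩ := hloc t ht
        obtain ⟨-, hsc, hs0, -⟩ := hs.self_of_nhds
        have h1 : ContinuousAt (fun u => ((f u / ‖s u‖ ^ 2 : ℝ) : ℂ)) t :=
          Complex.continuous_ofReal.continuousAt.comp (hf.continuousAt.div (hsc.norm.pow 2)
            (pow_ne_zero 2 (norm_ne_zero_iff.2 hs0)))
        refine (SectionContinuousAt.smul h1 ((hsc.mul (Γ₀.continuousAt x t)).mul hsc.star)).congr ?_
        filter_upwards [hs] with u hu
        obtain ⟨huU, -, hu0, huL⟩ := hu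
        obtain ⟨c, hc⟩ := Submodule.mem_span_singleton.1
          (((hw1 u huU).2.symm.trans huL) ▸ Submodule.mem_span_singleton_self (w u))
        have hcn : ‖c‖ * ‖s u‖ = 1 := by rw [← norm_smul, hc, (hw1 u huU).1]
        have hsn : ‖s u‖ ≠ 0 := norm_ne_zero_iff.2 hu0
        have h2 : c * star c = ((1 / ‖s u‖ ^ 2 : ℝ) : ℂ) := by
          rw [← eq_div_iff hsn] at hcn
          change c * (starRingEnd ℂ) c = _
          rw [Complex.mul_conj, Complex.normSq_eq_norm_sq, hcn, div_pow, one_pow]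
        rw [hT, ← hc, star_smul]
        simp only [smul_mul_assoc, mul_smul_comm, smul_smul]
        congr 1
        rw [mul_left_comm, mul_comm (star c), h2, ← Complex.ofReal_mul, mul_one_div]
      · refine .of_tendsto_zero (by rw [hT]; simp [hf0 t ht]) ?_
        refine squeeze_zero (fun u => norm_nonneg _) (fun u => hTf u _) ?_
        have h1 := (hf.continuousAt (x := t)).mul (Γ₀.continuousAt x t).norm
        rw [ContinuousAt, Pi.mul_apply, hf0 t ht, zero_mul] at h1
        exact h1
  exact ⟨φ, w, fun x t => (hφ x t).trans (hT t _), hw1⟩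

end LineBundles

section MainTheorem

variable {n : ℕ} {X : Type*} [TopologicalSpace X] [T2Space X] [LocallyCompactSpace X]
  {E : X → Type*} [∀ t, CStarAlgebra (E t)]
  [TopologicalSpace (TotalSpace (Matrix (Fin n) (Fin n) ℂ) E)] [IsMatrixBundle n E]

theorem IsMulBy.mem_TM_of_forall_isTrivialLineBundleOn {φ : Γ₀ n E →L[ℂ] Γ₀ n E} {a b : ∀ t, E t}
    (h : IsMulBy φ a b)
    (hL : ∀ U : Set X, IsOpen U → ∀ L : ∀ t, Submodule ℂ (E t),
      IsLineSubbundleOn n L U → IsTrivialLineBundleOn n L U) : φ ∈ TM (Γ₀ n E) := by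
  let U : Set X := {t | a t ≠ 0 ∧ b t ≠ 0}
  have hloc : ∀ t ∈ U, ∃ V : Set X, IsOpen V ∧ t ∈ V ∧ V ⊆ U ∧ ∃ s : ∀ t, E t, ∀ u ∈ V,
      SectionContinuousAt n E s u ∧ s u ≠ 0 ∧ (ℂ ∙ a u) = ℂ ∙ s u := by
    intro t ht
    obtain ⟨x, hx⟩ : ∃ x, (φ x : lp E ∞) t ≠ 0 := by
      by_contra! h0
      obtain ⟨e, ψ, hte, -⟩ := exists_chart n E t
      refine not_or.2 ht (eq_zero_or_eq_zero_of_forall_mul_mul_eq_zero (ψ t hte) fun v => ?_)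
      obtain ⟨x, rfl⟩ := exists_eval_eq (n := n) t v
      rw [← h, h0]
    obtain ⟨s, hs⟩ := h.exists_local_section ht.1 ht.2
    have h1 := (Γ₀.continuousAt (φ x) t).norm.eventually_ne (norm_ne_zero_iff.2 hx)
    obtain ⟨V, hV, hVo, htV⟩ := eventually_nhds_iff.1 (hs.and h1)
    refine ⟨V, hVo, htV, fun u hu => ?_, s, fun u hu => ⟨(hV u hu).1.1, (hV u hu).1.2.1, ?_⟩⟩
    · have h2 := norm_ne_zero_iff.1 (hV u hu).2
      rw [h] at h2
      exact ⟨fun h3 => h2 (by simp [h3]), fun h3 => h2 (by simp [h3])⟩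
    · obtain ⟨-, hsu, c, hc⟩ := (hV u hu).1
      have hc0 : c ≠ 0 := by
        rintro rfl
        exact hsu (by rw [hc, zero_smul])
      rw [hc, Submodule.span_singleton_smul_eq (IsUnit.mk0 c hc0)]
  have hU : IsOpen U := isOpen_iff_mem_nhds.2 fun t ht => by
    obtain ⟨V, hV, htV, hVU, -⟩ := hloc t ht
    exact mem_of_superset (hV.mem_nhds htV) hVU
  obtain ⟨s, hs⟩ := (hL U hU (fun t => ℂ ∙ a t) fun t ht => by
    obtain ⟨V, hV, htV, hVU, s, hs⟩ := hloc t ht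
    exact ⟨V, hV, htV, hVU, isTrivialLineBundleOn_of_section hs⟩).exists_section hU
  have hc : ∀ t, ∃ c : ℂ, t ∈ U → a t = c • s t := fun t => by
    by_cases ht : t ∈ U
    · obtain ⟨c, hc⟩ := Submodule.mem_span_singleton.1
        ((hs t ht).2.2 ▸ Submodule.mem_span_singleton_self (a t))
      exact ⟨c, fun _ => hc.symm⟩
    · exact ⟨0, fun h => absurd h ht⟩
  choose c hc using hc
  have hc0 : ∀ t ∉ U, a t = 0 ∨ b t = 0 := fun t ht => by
    by_contra! h0
    exact ht h0
  classical
  have h' : IsMulBy φ (fun t => if t ∈ U then s t else 0) (fun t => c t • b t) := fun x t => by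
    rw [h x t]
    by_cases ht : t ∈ U
    · simp only [ht, if_true]
      rw [hc t ht, smul_mul_assoc, smul_mul_assoc, mul_smul_comm]
    · rcases hc0 t ht with h0 | h0 <;> simp [ht, h0]
  obtain ⟨a', b', hab, ha', hb', hna, hnb⟩ := h'.exists_rescale fun t hat _ => by
    have ht : t ∈ U := by
      by_contra ht
      exact hat (if_neg ht)
    have h1 : SectionContinuousAt n E (fun t => if t ∈ U then s t else 0) t :=
      (hs t ht).1.congr (by filter_upwards [hU.mem_nhds ht] with u hu; rw [if_pos hu])
    exact ⟨h1, h'.continuousAt_right h1 hat⟩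
  exact hab.mem_TM ha' hb' (Real.sqrt_nonneg ‖φ‖)
    (fun t => (hna t).le.trans (Real.sqrt_le_sqrt (h'.norm_mul_norm_le t)))
    fun t => (hnb t).le.trans (Real.sqrt_le_sqrt (h'.norm_mul_norm_le t))

theorem IB₁_eq_TM_of_forall_isTrivialLineBundleOn
    (hL : ∀ U : Set X, IsOpen U → ∀ L : ∀ t, Submodule ℂ (E t),
      IsLineSubbundleOn n L U → IsTrivialLineBundleOn n L U) : IB₁ n E = TM (Γ₀ n E) := by
  refine Subset.antisymm (fun φ hφ => ?_) fun φ hφ => ?_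
  · obtain ⟨a, b, h⟩ := mem_IB₁_iff.1 hφ
    exact h.mem_TM_of_forall_isTrivialLineBundleOn hL
  · obtain ⟨a, b, h, -⟩ := exists_isMulBy_of_mem_TM hφ
    exact mem_IB₁_iff.2 ⟨a, b, h⟩

theorem IB₀₁_eq_TM₀_of_IB₁_eq_TM (h : IB₁ n E = TM (Γ₀ n E)) : IB₀₁ n E = TM₀ (Γ₀ n E) := by
  refine Subset.antisymm (fun φ hφ => ?_) fun φ hφ => ?_
  · obtain ⟨⟨hI, -, h0⟩, h1⟩ := hφ
    rw [h] at h1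
    obtain ⟨a, b, hab, ha, hb⟩ := exists_isMulBy_of_mem_TM h1
    simp only [hab.norm_fibreOp] at h0
    obtain ⟨a', b', hab', ha', hb', hna, hnb⟩ := hab.exists_rescale fun t _ _ => ⟨ha t, hb t⟩
    have h2 := h0.sqrt
    rw [Real.sqrt_zero] at h2
    obtain ⟨x, hx⟩ := Γ₀.exists_of_continuous ha' (by simpa only [hna] using h2)
    obtain ⟨y, hy⟩ := Γ₀.exists_of_continuous hb' (by simpa only [hnb] using h2)
    exact mem_TM₀_iff.2 ⟨x, y, fun z t => by rw [hx, hy, hab']⟩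
  · obtain ⟨a, b, hab⟩ := mem_TM₀_iff.1 hφ
    refine ⟨⟨hab.mem_IB, ?_, ?_⟩, mem_IB₁_iff.2 ⟨_, _, hab⟩⟩
    · simp only [hab.norm_fibreOp]
      exact continuous_iff_continuousAt.2 fun t =>
        (Γ₀.continuousAt a t).norm.mul (Γ₀.continuousAt b t).norm
    · simp only [hab.norm_fibreOp]
      simpa using (Γ₀.tendsto_norm a).mul (Γ₀.tendsto_norm b)

variable (n E) in
/-- If `Γ₀(E)` is separable, every open subset of `X` is the cozero set of a function in `C₀(X)`. -/
theorem exists_pos_on_isOpen (hn : 1 ≤ n) [TopologicalSpace.SeparableSpace (Γ₀ n E)] {U : Set X}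
    (hU : IsOpen U) : ∃ f : X → ℝ, Continuous f ∧ Tendsto f (cocompact X) (𝓝 0) ∧
      (∀ t, f t ∈ Icc (0 : ℝ) 1) ∧ (∀ t ∈ U, 0 < f t) ∧ ∀ t ∉ U, f t = 0 := by
  let S : Set (Γ₀ n E) := {x | ∀ t ∉ U, (x : lp E ∞) t = 0}
  have : TopologicalSpace.SeparableSpace S := TopologicalSpace.IsSeparable.separableSpace
    (TopologicalSpace.IsSeparable.of_separableSpace S)
  have : Nonempty S := ⟨0, fun t _ => by simp⟩
  let d : ℕ → S := TopologicalSpace.denseSeq S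
  let g : ℕ → X → ℝ := fun k t => (1 / 2) ^ (k + 1) * min 1 ‖((d k : Γ₀ n E) : lp E ∞) t‖
  have hg0 : ∀ k t, 0 ≤ g k t := fun k t => by positivity
  have hg1 : ∀ k t, ‖g k t‖ ≤ (1 / 2) ^ (k + 1) := fun k t => by
    rw [Real.norm_of_nonneg (hg0 k t)]
    exact mul_le_of_le_one_right (by positivity) (min_le_left _ _)
  have hsum : HasSum (fun k : ℕ => (1 / 2 : ℝ) ^ (k + 1)) 1 := by
    simpa [pow_succ] using hasSum_geometric_two.mul_right (1 / 2 : ℝ)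
  have hgs : ∀ t, Summable fun k => g k t := fun t =>
    .of_norm_bounded hsum.summable fun k => hg1 k t
  refine ⟨fun t => ∑' k, g k t, ?_, ?_, fun t => ⟨tsum_nonneg fun k => hg0 k t, ?_⟩, fun t ht => ?_,
    fun t ht => ?_⟩
  · refine continuous_tsum (fun k => ?_) hsum.summable hg1
    exact continuous_const.mul (continuous_const.min (continuous_iff_continuousAt.2 fun t =>
      (Γ₀.continuousAt _ t).norm))
  · have h1 : Tendsto (fun t => ∑' k, g k t) (cocompact X) (𝓝 (∑' _ : ℕ, (0 : ℝ))) := by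
      refine tendsto_tsum_of_dominated_convergence hsum.summable (fun k => ?_)
        (Eventually.of_forall fun t k => hg1 k t)
      have h2 := ((tendsto_const_nhds (x := (1 : ℝ))).min
        (Γ₀.tendsto_norm (d k : Γ₀ n E))).const_mul ((1 / 2 : ℝ) ^ (k + 1))
      rwa [min_eq_right zero_le_one, mul_zero] at h2
    simpa using h1
  · rw [← hsum.tsum_eq]
    exact (hgs t).tsum_le_tsum (fun k => (le_abs_self _).trans (hg1 k t)) hsum.summable
  · obtain ⟨x, hx1, hx0⟩ := Γ₀.exists_one n E (isCompact_singleton (x := t)) hU (by simpa using ht)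
    obtain ⟨_, ⟨k, rfl⟩, hk⟩ := Metric.mem_closure_iff.1
      (TopologicalSpace.denseRange_denseSeq S ⟨x, hx0⟩) 1 one_pos
    have hne : ((d k : Γ₀ n E) : lp E ∞) t ≠ 0 := by
      intro h0
      have h1 := Γ₀.norm_apply_le (x - (d k : Γ₀ n E)) t
      have : Nontrivial (E t) := by
        obtain ⟨e, ψ, hte, -⟩ := exists_chart n E t
        have : NeZero n := ⟨by omega⟩
        exact (EquivLike.surjective (ψ t hte)).nontrivial
      rw [Γ₀.sub_apply, h0, sub_zero, (hx1 t rfl).self_of_nhds, norm_one] at h1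
      rw [Subtype.dist_eq, dist_eq_norm] at hk
      exact absurd h1 (not_le.2 hk)
    exact (hgs t).tsum_pos (fun k => hg0 k t) k
      (mul_pos (by positivity) (lt_min one_pos (norm_pos_iff.2 hne)))
  · have h1 : ∀ k, g k t = 0 := fun k => by simp [g, (d k).2 t ht]
    simp [h1]

theorem isTrivialLineBundleOn_of_IB₀₁_eq_TM₀ (hn : 1 ≤ n)
    [TopologicalSpace.SeparableSpace (Γ₀ n E)] (h : IB₀₁ n E = TM₀ (Γ₀ n E)) {U : Set X}
    (hU : IsOpen U) {L : ∀ t, Submodule ℂ (E t)} (hL : IsLineSubbundleOn n L U) :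
    IsTrivialLineBundleOn n L U := by
  obtain ⟨f, hf, hfc, hf1, hfU, hf0⟩ := exists_pos_on_isOpen n E hn hU
  obtain ⟨φ, w, hφ, hw⟩ := hL.exists_isMulBy hf hf1 hf0
  have hnorm : ∀ t, ‖(f t : ℂ) • w t‖ * ‖star (w t)‖ = f t := fun t => by
    rw [norm_smul, norm_star, Complex.norm_real, Real.norm_of_nonneg (hf1 t).1]
    by_cases ht : t ∈ U
    · simp [(hw t ht).1]
    · simp [hf0 t ht]
  have hmem : φ ∈ IB₀₁ n E := by
    refine ⟨⟨hφ.mem_IB, ?_, ?_⟩, mem_IB₁_iff.2 ⟨_, _, hφ⟩⟩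
    · simpa only [hφ.norm_fibreOp, hnorm] using hf
    · simpa only [hφ.norm_fibreOp, hnorm] using hfc
  rw [h] at hmem
  obtain ⟨a, b, hab⟩ := mem_TM₀_iff.1 hmem
  refine isTrivialLineBundleOn_of_section (s := (a : lp E ∞)) fun t ht => ?_
  have hnab : ‖(a : lp E ∞) t‖ * ‖(b : lp E ∞) t‖ = f t := by
    rw [← hab.norm_fibreOp hφ.mem_IB, hφ.norm_fibreOp, hnorm]
  have ha0 : (a : lp E ∞) t ≠ 0 := fun h0 => (hfU t ht).ne (by simpa [h0] using hnab)
  have hb0 : (b : lp E ∞) t ≠ 0 := fun h0 => (hfU t ht).ne (by simpa [h0] using hnab)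
  refine ⟨Γ₀.continuousAt a t, ha0, ?_⟩
  obtain ⟨e, ψ, hte, -⟩ := exists_chart n E t
  obtain ⟨c, hc⟩ := exists_eq_smul_of_forall_mul_mul_eq (ψ t hte)
    (a := (a : lp E ∞) t) (a' := (f t : ℂ) • w t) (b' := star (w t)) (fun v => by
    obtain ⟨x, rfl⟩ := exists_eval_eq (n := n) t v
    rw [← hab x t, hφ x t]) hb0
  have hc' : (a : lp E ∞) t = (c * f t) • w t := by rw [hc, smul_smul]
  rw [(hw t ht).2, hc', Submodule.span_singleton_smul_eq (IsUnit.mk0 _ fun h0 => ha0 (by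
    rw [hc', h0, zero_smul]))]

end MainTheorem

theorem theorem5p13 (n : ℕ) (hn : 1 ≤ n) {X : Type*} [TopologicalSpace X] [T2Space X]
    [LocallyCompactSpace X] (E : X → Type*) [∀ t, CStarAlgebra (E t)]
    [TopologicalSpace (TotalSpace (Matrix (Fin n) (Fin n) ℂ) E)] [IsMatrixBundle n E] :
    ((∀ U : Set X, IsOpen U → ∀ L : ∀ t, Submodule ℂ (E t),
        IsLineSubbundleOn n L U → IsTrivialLineBundleOn n L U) → IB₁ n E = TM (Γ₀ n E)) ∧
    (IB₁ n E = TM (Γ₀ n E) → IB₀₁ n E = TM₀ (Γ₀ n E)) ∧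
    (TopologicalSpace.SeparableSpace (Γ₀ n E) →
      [∀ U : Set X, IsOpen U → ∀ L : ∀ t, Submodule ℂ (E t),
          IsLineSubbundleOn n L U → IsTrivialLineBundleOn n L U,
        IB₁ n E = TM (Γ₀ n E),
        IB₀₁ n E = TM₀ (Γ₀ n E)].TFAE) := by
  refine ⟨IB₁_eq_TM_of_forall_isTrivialLineBundleOn, IB₀₁_eq_TM₀_of_IB₁_eq_TM, fun _ => ?_⟩
  tfae_have 1 → 2 := IB₁_eq_TM_of_forall_isTrivialLineBundleOn
  tfae_have 2 → 3 := IB₀₁_eq_TM₀_of_IB₁_eq_TM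
  tfae_have 3 → 1 := fun h _ hU _ hL => isTrivialLineBundleOn_of_IB₀₁_eq_TM₀ hn h hU hL
  tfae_finish
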